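/- For rational numbers $a,b$ and a prime $p$, write $a\equiv b\pmod{p^2}$ if $a-b=p^2c$ for some rational number $c$ whose denominator in lowest terms is not divisible by $p$. Let $p$ be a prime. (1) If $p\equiv 3\pmod 4$, then $$\sum_{k=0}^{p-1}\binom{2k}{k}^2\frac{1}{32^k}\equiv 0\pmod{p^2}.$$ (2) If $p\equiv 1\pmod 4$ and $x,y$ are integers such that $p=x^2+y^2$ and $x\equiv 1\pmod 4$, then $$\sum_{k=0}^{p-1}\binom{2k}{k}^2\frac{1}{32^k}\equiv 2x-\frac{p}{2x}\pmod{p^2}.$$ -/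

import Mathlib

/-- Congruence `a ≡ b (mod n)` between rational numbers: `a - b` is `n` times a rational number
whose denominator (in lowest terms) is prime to `n`. When `n` is a power of a prime `p`, this is
congruence modulo `n` in the ring of `p`-integral rationals. -/
def RatModEq (n : ℕ) (a b : ℚ) : Prop :=
  ∃ c : ℚ, c.den.Coprime n ∧ a - b = (n : ℚ) * c

/-! Put n = (p-1)/2. Modulo p² one has C(2k,k)² ≡ (-16)^k C(n,k) C(n+k,n) for k < p, because
4(n-k)(n+k+1) = p² - (2k+1)² (`centralBinom_sq_eq_zmod_sq`). The sum is thus congruent to the n-th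
shifted Legendre polynomial at its centre 1/2, which is 0 for odd n and (-1)^m C(2m,m)/4^m for n =
2m. This settles p ≡ 3 mod 4.

For p = 4m+1 it remains to find C = C(2m,m) modulo p², a congruence of Chowla, Dwork and Evans. It
comes from evaluating A = ∑ χ(t(1-t²)), χ the quadratic character, in two ways. Over ℤ, A is a
Jacobsthal sum; its second moment and a count modulo 8 give A = -(-1)^m 2x
(`two_mul_eq_neg_sum_quadraticChar`). Modulo p², χ is the 2m-th power of the Teichmüller lift T, and
T(1-s) = 1 - T(s) - p L(s) with L a truncated logarithm. Expanding to first order in p gives 2x =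
C(1 - pH/2) + p/C, where H = ∑_{j≤2m} (-1)^(j-1)/j (`ZMod.neg_sum_quadraticChar_eq`). The same
logarithm at the square roots of -1 gives (-1)^m 2^(2m) = 1 + pH/2 (`ZMod.two_pow_eq_mulP`), so H
cancels and (-1)^m C/4^m ≡ 2x - p/(2x). -/

/-! ### Shifted Legendre polynomials at 1/2 -/

open Polynomial in
theorem sum_shiftedLegendre_two_pow (n : ℕ) :
    ((∑ k ∈ Finset.range (n + 1),
      (-1 : ℤ) ^ k * n.choose k * (n + k).choose n * 2 ^ (n - k) : ℤ) : ℚ) =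
    2 ^ n * aeval (1 / 2 : ℚ) (shiftedLegendre n) := by
  simp only [shiftedLegendre, map_sum, Finset.mul_sum]
  push_cast
  refine Finset.sum_congr rfl fun k hk => ?_
  rw [Finset.mem_range] at hk
  have : (2 : ℚ) ^ n = 2 ^ (n - k) * 2 ^ k := by rw [← pow_add]; congr 1; omega
  simp only [map_mul, map_pow, aeval_X, aeval_C, this]
  simp
  field_simp

/-- The reflection x ↦ 1 - x multiplies the polynomial by (-1)^n and fixes 1/2. -/
theorem sum_shiftedLegendre_two_pow_odd (n : ℕ) (hn : Odd n) :
    ∑ k ∈ Finset.range (n + 1),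
      (-1 : ℤ) ^ k * n.choose k * (n + k).choose n * 2 ^ (n - k) = 0 := by
  have h := Polynomial.shiftedLegendre_eval_symm n (1 / 2 : ℚ)
  rw [hn.neg_one_pow] at h
  norm_num at h
  have h0 : Polynomial.aeval (1 / 2 : ℚ) (Polynomial.shiftedLegendre n) = 0 := by
    norm_num; linarith
  have := sum_shiftedLegendre_two_pow n
  rw [h0, mul_zero] at this
  exact_mod_cast this

-- By Rodrigues' formula the value is a Taylor coefficient of (X(1-X))^(2m) at 1/2; recentred there,
-- this polynomial is (1/4 - X²)^(2m), and the binomial theorem gives its middle coefficient.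
open Polynomial in
theorem aeval_half_shiftedLegendre_even (m : ℕ) :
    4 ^ m * aeval (1 / 2 : ℚ) (shiftedLegendre (2 * m)) = (-1) ^ m * (2 * m).choose m := by
  set q : ℚ[X] := X ^ (2 * m) * (1 - X) ^ (2 * m) with hq
  have h1 : ((2 * m).factorial : ℚ) * aeval (1 / 2 : ℚ) (shiftedLegendre (2 * m)) =
      (derivative^[2 * m] q).eval (1 / 2) := by
    have := congrArg (fun f : ℤ[X] => aeval (1 / 2 : ℚ) f)
      (factorial_mul_shiftedLegendre_eq (2 * m))
    simp only [map_mul, map_natCast] at this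
    rw [this, aeval_def, eval₂_eq_eval_map, ← Polynomial.iterate_derivative_map]
    simp [hq]
  have h2 : (derivative^[2 * m] q).eval (1 / 2) =
      (2 * m).factorial * (taylor (1 / 2) q).coeff (2 * m) := by
    rw [taylor_coeff, ← factorial_smul_hasseDeriv]
    simp
  have h3 : taylor (1 / 2) q = ((1 - (C 4 : ℚ[X]) * X ^ 2) ^ (2 * m)) * C ((1 / 4) ^ (2 * m)) := by
    rw [hq]
    simp only [taylor_mul, taylor_pow, map_sub, taylor_X, taylor_one, ← mul_pow, map_pow]
    congr 1
    have : (C (1 / 2) : ℚ[X]) = 2 * C (1 / 4) := by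
      rw [show (2 : ℚ[X]) = C 2 from rfl, ← C_mul]; norm_num
    have e : (C (1 / 4) : ℚ[X]) * 4 = 1 := by
      rw [show (4 : ℚ[X]) = C 4 from rfl, ← C_mul]; norm_num
    rw [this, show (C 4 : ℚ[X]) = 4 from rfl]
    simp only [map_one]
    linear_combination (X ^ 2 - X - C (1 / 4)) * e
  have h4 : ((1 - (C 4 : ℚ[X]) * X ^ 2) ^ (2 * m)).coeff (2 * m) =
      (-4 : ℚ) ^ m * (2 * m).choose m := by
    rw [show (1 - (C 4 : ℚ[X]) * X ^ 2) = C (-4) * X ^ 2 + 1 by rw [C_neg]; ring, add_pow,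
      finsetSum_coeff, Finset.sum_eq_single m]
    · rw [one_pow, mul_one, mul_pow, ← C_pow, ← pow_mul, ← C_eq_natCast, coeff_mul_C, coeff_C_mul,
        coeff_X_pow, if_pos rfl, mul_one]
    · intro k _ hk
      rw [one_pow, mul_one, mul_pow, ← C_pow, ← pow_mul, ← C_eq_natCast, coeff_mul_C, coeff_C_mul,
        coeff_X_pow, if_neg (by omega), mul_zero, zero_mul]
    · intro h
      exact absurd (Finset.mem_range.2 (by omega)) h
  have h5 : ((2 * m).factorial : ℚ) ≠ 0 := by exact_mod_cast (2 * m).factorial_ne_zero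
  rw [h2, h3, coeff_mul_C, h4] at h1
  rw [mul_left_cancel₀ h5 h1, pow_mul, show (-4 : ℚ) = -1 * 4 by norm_num, mul_pow]
  have e : (4 : ℚ) ^ m * 4 ^ m * ((1 / 4) ^ 2) ^ m = 1 := by
    rw [← mul_pow, ← mul_pow]; norm_num
  linear_combination ((-1) ^ m * ((2 * m).choose m : ℚ)) * e

theorem sum_shiftedLegendre_two_pow_even (m : ℕ) :
    ∑ k ∈ Finset.range (2 * m + 1),
      (-1 : ℤ) ^ k * (2 * m).choose k * (2 * m + k).choose (2 * m) * 2 ^ (2 * m - k) =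
    (-1) ^ m * (2 * m).choose m := by
  have h := sum_shiftedLegendre_two_pow (2 * m)
  rw [pow_mul, show (2 : ℚ) ^ 2 = 4 by norm_num, aeval_half_shiftedLegendre_even] at h
  exact_mod_cast h

/-! ### Central binomial coefficients modulo p² -/

theorem ZMod.isUnit_natCast_prime_sq {p : ℕ} (hp : p.Prime) {k : ℕ} (h0 : 0 < k) (hk : k < p) :
    IsUnit (k : ZMod (p ^ 2)) :=
  (ZMod.isUnit_iff_coprime k (p ^ 2)).2
    (Nat.Coprime.pow_right 2 (Nat.coprime_of_lt_prime h0.ne' hk hp).symm)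

/-- The ratios of consecutive terms are 4(2k+1)²/(k+1)² and -16(n-k)(n+k+1)/(k+1)². They agree since
4(n-k)(n+k+1) = p² - (2k+1)², and k+1 < p is a unit. -/
theorem centralBinom_sq_eq_zmod_sq {p n : ℕ} (hp : p.Prime) (hn : p = 2 * n + 1) (k : ℕ)
    (hk : k < p) :
    ((2 * k).choose k : ZMod (p ^ 2)) ^ 2 =
      16 ^ k * (-1) ^ k * (n.choose k * (n + k).choose n) := by
  induction k with
  | zero => simp
  | succ k ih =>
    have ih := ih (by omega)
    have hu : IsUnit ((2 * (k + 1) : ZMod (p ^ 2)) ^ 2) := by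
      refine IsUnit.pow 2 (IsUnit.mul ?_ ?_)
      · exact_mod_cast ZMod.isUnit_natCast_prime_sq hp (k := 2) (by norm_num)
          (lt_of_le_of_ne hp.two_le (by omega))
      · exact_mod_cast ZMod.isUnit_natCast_prime_sq hp (k := k + 1) (by omega) hk
    have h1 : ((k : ZMod (p ^ 2)) + 1) * (2 * (k + 1)).choose (k + 1) =
        2 * (2 * k + 1) * (2 * k).choose k := by
      have := Nat.succ_mul_centralBinom_succ k
      rw [Nat.centralBinom_eq_two_mul_choose, Nat.centralBinom_eq_two_mul_choose] at this
      exact_mod_cast congrArg (Nat.cast : ℕ → ZMod (p ^ 2)) this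
    have h2 : ((k : ZMod (p ^ 2)) + 1) * n.choose (k + 1) = (n - k) * n.choose k := by
      have := congrArg (Nat.cast : ℕ → ZMod (p ^ 2)) (Nat.choose_succ_right_eq n k)
      push_cast at this
      rcases le_or_gt k n with h | h
      · rw [Nat.cast_sub h] at this
        linear_combination this
      · rw [Nat.choose_eq_zero_of_lt h, Nat.choose_eq_zero_of_lt (by omega)]; simp
    have h3 : ((k : ZMod (p ^ 2)) + 1) * (n + (k + 1)).choose n =
        (n + k + 1) * (n + k).choose n := by
      have := congrArg (Nat.cast : ℕ → ZMod (p ^ 2)) (Nat.add_one_mul_choose_eq (n + k) k)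
      rw [show (n + k).choose k = (n + k).choose n from Nat.choose_symm_add.symm,
        show n + k + 1 = n + (k + 1) from rfl,
        show (n + (k + 1)).choose (k + 1) = (n + (k + 1)).choose n from
          Nat.choose_symm_add.symm] at this
      push_cast at this
      linear_combination -this
    have h4 : (2 * (n : ZMod (p ^ 2)) + 1) ^ 2 = 0 := by
      have : ((p ^ 2 : ℕ) : ZMod (p ^ 2)) = 0 := ZMod.natCast_self _
      rw [← this]
      push_cast [hn]
      ring
    apply hu.mul_left_cancel
    calc (2 * ((k : ZMod (p ^ 2)) + 1)) ^ 2 * ((2 * (k + 1)).choose (k + 1) : ZMod (p ^ 2)) ^ 2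
        = 4 * (((k : ZMod (p ^ 2)) + 1) * (2 * (k + 1)).choose (k + 1)) ^ 2 := by ring
      _ = 16 * (2 * k + 1) ^ 2 * ((2 * k).choose k : ZMod (p ^ 2)) ^ 2 := by rw [h1]; ring
      _ = 16 * (2 * k + 1) ^ 2 * (16 ^ k * (-1) ^ k * (n.choose k * (n + k).choose n)) := by
          rw [ih]
      _ = 16 ^ (k + 1) * (-1) ^ (k + 1) * 4 * (((n - k) * n.choose k) *
            ((n + k + 1) * (n + k).choose n)) := by
          linear_combination (16 ^ (k + 1) * (-1) ^ k *
            (n.choose k * (n + k).choose n : ZMod (p ^ 2))) * h4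
      _ = _ := by rw [← h2, ← h3]; ring

theorem sum_centralBinom_sq_eq_zmod_sq {p n : ℕ} (hp : p.Prime) (hn : p = 2 * n + 1) :
    ∑ k ∈ Finset.range p, ((2 * k).choose k : ZMod (p ^ 2)) ^ 2 * 32 ^ (p - 1 - k) =
      16 ^ (2 * n) * 2 ^ n * ((∑ k ∈ Finset.range (n + 1),
        (-1 : ℤ) ^ k * n.choose k * (n + k).choose n * 2 ^ (n - k) : ℤ) : ZMod (p ^ 2)) := by
  have h1 : ∑ k ∈ Finset.range p, ((2 * k).choose k : ZMod (p ^ 2)) ^ 2 * 32 ^ (p - 1 - k) =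
      ∑ k ∈ Finset.range p, 16 ^ k * (-1) ^ k * (n.choose k * (n + k).choose n : ZMod (p ^ 2)) *
        32 ^ (p - 1 - k) :=
    Finset.sum_congr rfl fun k hk => by
      rw [centralBinom_sq_eq_zmod_sq hp hn k (Finset.mem_range.1 hk)]
  rw [h1, ← Finset.sum_subset (s₁ := Finset.range (n + 1))
    (Finset.range_subset_range.2 (by omega))]
  · push_cast
    rw [Finset.mul_sum]
    refine Finset.sum_congr rfl fun k hk => ?_
    rw [Finset.mem_range] at hk
    have e1 : (32 : ZMod (p ^ 2)) ^ (p - 1 - k) = 16 ^ (2 * n - k) * (2 ^ n * 2 ^ (n - k)) := by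
      rw [← pow_add, show (32 : ZMod (p ^ 2)) = 16 * 2 by norm_num, mul_pow]
      congr 2 <;> omega
    have e2 : (16 : ZMod (p ^ 2)) ^ (2 * n) = 16 ^ k * 16 ^ (2 * n - k) := by
      rw [← pow_add]; congr 1; omega
    rw [e1, e2]
    ring
  · intro k _ hk
    rw [Finset.mem_range] at hk
    rw [Nat.choose_eq_zero_of_lt (by omega)]
    simp

/-! ### Teichmüller lifts and the truncated logarithm -/

theorem sum_Ico_one_two_mul_add_one {A : Type*} [AddCommMonoid A] (f : ℕ → A) (N : ℕ) :
    ∑ k ∈ Finset.Ico 1 (2 * N + 1), f k =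
      ∑ j ∈ Finset.Icc 1 N, (f (2 * j - 1) + f (2 * j)) := by
  induction N with
  | zero => simp
  | succ N ih =>
    rw [show 2 * (N + 1) + 1 = 2 * N + 1 + 1 + 1 by ring, Finset.sum_Ico_succ_top (by omega),
      Finset.sum_Ico_succ_top (by omega), ih, Finset.sum_Icc_succ_top (by omega), add_assoc]
    rfl

namespace ZMod

/-- Reduction from `ℤ / p²` to `ℤ / p`. -/
def redSq (p : ℕ) : ZMod (p ^ 2) →+* ZMod p := ZMod.castHom (dvd_pow_self p two_ne_zero) (ZMod p)

/-- The additive map `ℤ / p → ℤ / p²` induced by multiplication by `p`. -/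
def mulP (p : ℕ) : ZMod p →+ ZMod (p ^ 2) :=
  ZMod.lift p ⟨(AddMonoidHom.mulLeft (p : ZMod (p ^ 2))).comp (Int.castAddHom _), by
    have : ((p ^ 2 : ℕ) : ZMod (p ^ 2)) = 0 := ZMod.natCast_self _
    simpa [pow_two] using this⟩

/-- The Teichmüller lift from `ℤ / p` to `ℤ / p²`. -/
def teich (p : ℕ) (t : ZMod p) : ZMod (p ^ 2) := (t.val : ZMod (p ^ 2)) ^ p

section
variable {p : ℕ}

theorem redSq_natCast (k : ℕ) : redSq p k = k := map_natCast _ k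

theorem mulP_redSq (z : ZMod (p ^ 2)) : mulP p (redSq p z) = p * z := by
  obtain ⟨k, rfl⟩ := ZMod.intCast_surjective z
  rw [map_intCast]
  exact ZMod.lift_coe p _ k

theorem redSq_surjective : Function.Surjective (redSq p) := fun a => by
  obtain ⟨k, rfl⟩ := ZMod.intCast_surjective a
  exact ⟨k, map_intCast _ k⟩

theorem mulP_one : mulP p 1 = p := by
  simpa using mulP_redSq (p := p) 1

theorem mulP_mul (a : ZMod p) (z : ZMod (p ^ 2)) : mulP p a * z = mulP p (a * redSq p z) := by
  obtain ⟨w, rfl⟩ := redSq_surjective a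
  rw [← map_mul, mulP_redSq, mulP_redSq, mul_assoc]

theorem redSq_mulP (a : ZMod p) : redSq p (mulP p a) = 0 := by
  obtain ⟨w, rfl⟩ := redSq_surjective a
  rw [mulP_redSq, map_mul, map_natCast, ZMod.natCast_self, zero_mul]

theorem mulP_mul_mulP (a b : ZMod p) : mulP p a * mulP p b = 0 := by
  rw [mulP_mul, redSq_mulP, mul_zero, map_zero]

/-- The ideal pℤ/p² has square zero, so only the first-order term survives. -/
theorem add_mulP_pow (z : ZMod (p ^ 2)) (a : ZMod p) (n : ℕ) :
    (z + mulP p a) ^ n = z ^ n + mulP p (n * redSq p z ^ (n - 1) * a) := by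
  induction n with
  | zero => simp
  | succ n ih =>
    rw [pow_succ (z + mulP p a), ih, add_mul, mul_add, mul_add, mulP_mul_mulP, add_zero, mulP_mul,
      mul_comm _ (mulP p a), mulP_mul, pow_succ z, add_assoc, ← map_add, map_pow]
    congr 2
    -- The truncated exponent `n - 1` is wrong only at `n = 0`, where the factor `n` vanishes.
    rcases n with _ | n
    · simp
    · push_cast
      ring

variable [Fact p.Prime]

/-- Congruence modulo p becomes congruence modulo p² after taking p-th powers. Multiplicativity of
the lift follows from this. -/
theorem pow_eq_teich (z : ZMod (p ^ 2)) : z ^ p = teich p (redSq p z) := by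
  unfold teich
  set w : ZMod (p ^ 2) := ((redSq p z).val : ZMod (p ^ 2))
  have h : redSq p (z - w) = 0 := by
    rw [map_sub, redSq_natCast, ZMod.natCast_zmod_val, sub_self]
  have h1 : (p : ZMod (p ^ 2)) ∣ z - w := by
    obtain ⟨k, hk⟩ := ZMod.intCast_surjective (z - w)
    rw [← hk, map_intCast, ZMod.intCast_zmod_eq_zero_iff_dvd] at h
    rw [← hk]
    simpa using map_dvd (Int.castRingHom (ZMod (p ^ 2))) h
  have h2 := dvd_sub_pow_of_dvd_sub h1 1
  have h3 : ((p ^ 2 : ℕ) : ZMod (p ^ 2)) = 0 := ZMod.natCast_self _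
  push_cast at h3
  rw [show 1 + 1 = 2 from rfl, h3, zero_dvd_iff, pow_one] at h2
  exact sub_eq_zero.1 h2

theorem redSq_teich (t : ZMod p) : redSq p (teich p t) = t := by
  rw [teich, map_pow, redSq_natCast, ZMod.natCast_zmod_val, ZMod.pow_card]

theorem teich_pow_p (t : ZMod p) : teich p t ^ p = teich p t := by
  rw [pow_eq_teich, redSq_teich]

theorem teich_mul (s t : ZMod p) : teich p (s * t) = teich p s * teich p t := by
  rw [← teich_pow_p s, ← teich_pow_p t, ← mul_pow, pow_eq_teich, map_mul, redSq_teich, redSq_teich]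

theorem teich_zero : teich p 0 = 0 := by
  rw [← map_zero (redSq p), ← pow_eq_teich, zero_pow (Fact.out : p.Prime).ne_zero]

theorem teich_one : teich p 1 = 1 := by
  rw [← map_one (redSq p), ← pow_eq_teich, one_pow]

theorem teich_pow (t : ZMod p) (k : ℕ) : teich p (t ^ k) = teich p t ^ k := by
  induction k with
  | zero => simp [teich_one]
  | succ k ih => rw [pow_succ t, teich_mul, ih, pow_succ (teich p t)]

theorem teich_neg (hp : Odd p) (t : ZMod p) : teich p (-t) = -teich p t := by
  rw [← teich_pow_p t, ← hp.neg_pow, pow_eq_teich, map_neg, redSq_teich]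

theorem natCast_ne_zero_of_lt {k : ℕ} (h0 : 0 < k) (hk : k < p) : (k : ZMod p) ≠ 0 := by
  rw [Ne, ZMod.natCast_eq_zero_iff]
  exact Nat.not_dvd_of_pos_of_lt h0 hk

theorem choose_pred_prime (k : ℕ) (hk : k < p) : ((p - 1).choose k : ZMod p) = (-1) ^ k := by
  induction k with
  | zero => simp
  | succ k ih =>
    have h := Nat.choose_succ_succ (p - 1) k
    rw [Nat.succ_eq_add_one, Nat.sub_add_cancel (Fact.out : p.Prime).one_le] at h
    have h1 : (p.choose k.succ : ZMod p) = 0 :=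
      (ZMod.natCast_eq_zero_iff _ _).2 ((Fact.out : p.Prime).dvd_choose_self (by simp) hk)
    have h2 := congrArg (Nat.cast : ℕ → ZMod p) h
    rw [h1] at h2
    push_cast at h2
    rw [ih (by omega)] at h2
    rw [pow_succ]
    linear_combination -h2

theorem choose_prime_eq_mulP {k : ℕ} (h0 : 0 < k) (hk : k < p) :
    (p.choose k : ZMod (p ^ 2)) = mulP p ((-1) ^ (k - 1) * (k : ZMod p)⁻¹) := by
  have hp : p.Prime := Fact.out
  obtain ⟨c, hc⟩ := hp.dvd_choose_self h0.ne' hk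
  have h := Nat.add_one_mul_choose_eq (p - 1) (k - 1)
  rw [Nat.sub_add_cancel hp.one_le, Nat.sub_add_cancel h0, hc, mul_assoc] at h
  have h1 := congrArg (Nat.cast : ℕ → ZMod p) (Nat.eq_of_mul_eq_mul_left hp.pos h)
  push_cast at h1
  rw [choose_pred_prime _ (by omega)] at h1
  have hk0 := natCast_ne_zero_of_lt h0 hk
  rw [h1, mul_assoc, mul_inv_cancel₀ hk0, mul_one, hc, ← redSq_natCast c, mulP_redSq]
  push_cast
  rfl

/-- The truncated logarithm `-log (1 - s)` in `ℤ / p`. -/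
def truncLog (p : ℕ) (s : ZMod p) : ZMod p := ∑ k ∈ Finset.Ico 1 p, s ^ k * (k : ZMod p)⁻¹

/-- Expand (1 - T(s))^p; the inner coefficients are C(p,k) ≡ p(-1)^(k-1)/k modulo p². -/
theorem teich_one_sub (hodd : Odd p) (s : ZMod p) :
    teich p (1 - s) = 1 - teich p s - mulP p (truncLog p s) := by
  have hp : p.Prime := Fact.out
  have h1 : teich p (1 - s) = (-teich p s + 1) ^ p := by
    rw [pow_eq_teich, map_add, map_neg, map_one, redSq_teich]
    congr 1; ring
  rw [h1, add_pow, Finset.sum_range_succ, Finset.range_eq_Ico,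
    Finset.sum_eq_sum_Ico_succ_bot hp.pos]
  have h2 : ∑ k ∈ Finset.Ico (0 + 1) p, (-teich p s) ^ k * 1 ^ (p - k) * (p.choose k : ZMod (p ^ 2))
      = - mulP p (truncLog p s) := by
    rw [truncLog, map_sum, ← Finset.sum_neg_distrib]
    refine Finset.sum_congr rfl fun k hk => ?_
    rw [Finset.mem_Ico] at hk
    rw [choose_prime_eq_mulP (by omega) hk.2, one_pow, mul_one, mul_comm, mulP_mul, ← map_neg,
      map_pow, map_neg, redSq_teich]
    congr 1
    obtain ⟨j, rfl⟩ : ∃ j, k = j + 1 := ⟨k - 1, by omega⟩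
    rw [Nat.add_sub_cancel, neg_pow s, pow_succ (-1 : ZMod p)]
    have : ((-1 : ZMod p) ^ j) * (-1) ^ j = 1 := by rw [← mul_pow]; simp
    linear_combination (-s ^ (j + 1) * ((j + 1 : ℕ) : ZMod p)⁻¹) * this
  rw [h2, hodd.neg_pow, teich_pow_p]
  simp
  ring

/-- For σ² = -1, (1+σ)² = 2σ, hence (1+σ)^p = (1+σ) 2^(2m) (-1)^m. On the other side (1+σ)^p is the
lift of 1 ± i, given by the logarithm. Adding the identities for σ = ±τ removes τ and the odd powers
in the logarithm. -/
theorem two_pow_eq_mulP {m : ℕ} (hm : p = 4 * m + 1) :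
    (2 : ZMod (p ^ 2)) ^ (2 * m) * (-1) ^ m =
      1 + mulP p ((∑ j ∈ Finset.Icc 1 (2 * m), (-1) ^ (j - 1) * (j : ZMod p)⁻¹) * 2⁻¹) := by
  have hp : p.Prime := Fact.out
  have hodd : Odd p := ⟨2 * m, by omega⟩
  have h2 : (2 : ZMod p) ≠ 0 := by
    exact_mod_cast natCast_ne_zero_of_lt (p := p) (k := 2) (by norm_num)
      (by have := hp.two_le; omega)
  obtain ⟨i, hi⟩ := (ZMod.exists_sq_eq_neg_one_iff (p := p)).2 (by omega)
  set τ := teich p i with hτ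
  have hτ2 : τ ^ 2 = -1 := by
    rw [hτ, pow_two (teich p i), ← teich_mul, ← hi, teich_neg hodd, teich_one]
  have key : ∀ σ : ZMod (p ^ 2), σ ^ 2 = -1 →
      (1 + σ) ^ p = (1 + σ) * (2 ^ (2 * m) * (-1) ^ m) := by
    intro σ hσ
    have e : (1 + σ) ^ 2 = 2 * σ := by linear_combination hσ
    calc (1 + σ) ^ p = (1 + σ) * ((1 + σ) ^ 2) ^ (2 * m) := by
          rw [← pow_mul, ← pow_succ', show 2 * (2 * m) + 1 = p by omega]
      _ = (1 + σ) * (2 ^ (2 * m) * (σ ^ 2) ^ m) := by rw [e, mul_pow, pow_mul σ]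
      _ = _ := by rw [hσ]
  have k1 := key τ hτ2
  have k2 := key (-τ) (by rw [neg_sq, hτ2])
  rw [pow_eq_teich, map_add, map_one, hτ, redSq_teich, ← sub_neg_eq_add, teich_one_sub hodd,
    teich_neg hodd, ← hτ] at k1
  rw [pow_eq_teich, map_add, map_one, map_neg, hτ, redSq_teich, ← sub_eq_add_neg,
    teich_one_sub hodd, ← hτ] at k2
  have hL : truncLog p i + truncLog p (-i) =
      - ∑ j ∈ Finset.Icc 1 (2 * m), (-1) ^ (j - 1) * (j : ZMod p)⁻¹ := by
    rw [truncLog, truncLog, ← Finset.sum_add_distrib,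
      show Finset.Ico 1 p = Finset.Ico 1 (2 * (2 * m) + 1) by
      congr 1; omega, sum_Ico_one_two_mul_add_one, ← Finset.sum_neg_distrib]
    refine Finset.sum_congr rfl fun j hj => ?_
    rw [Finset.mem_Icc] at hj
    obtain ⟨l, rfl⟩ : ∃ l, j = l + 1 := ⟨j - 1, by omega⟩
    have o : Odd (2 * (l + 1) - 1) := ⟨l, by omega⟩
    have ev : Even (2 * (l + 1)) := ⟨l + 1, by ring⟩
    rw [o.neg_pow, ev.neg_pow, pow_mul, pow_two, ← hi, Nat.add_sub_cancel, pow_succ]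
    push_cast
    rw [mul_inv]
    field_simp
    ring
  set H := ∑ j ∈ Finset.Icc 1 (2 * m), (-1) ^ (j - 1) * (j : ZMod p)⁻¹
  have hu : IsUnit (2 : ZMod (p ^ 2)) := by
    exact_mod_cast isUnit_natCast_prime_sq hp (k := 2) (by norm_num) (by have := hp.two_le; omega)
  apply hu.mul_left_cancel
  have h3 : mulP p (H * 2⁻¹) * 2 = mulP p H := by
    rw [mulP_mul, map_ofNat, mul_assoc, inv_mul_cancel₀ h2, mul_one]
  have h4 : mulP p (truncLog p i) + mulP p (truncLog p (-i)) = - mulP p H := by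
    rw [← map_add, hL, map_neg]
  linear_combination -k1 - k2 - h4 - h3

end

end ZMod

/-! ### Binomial sums with reciprocals -/

/-- Partial fractions for `N! / (z (z - 1) ⋯ (z - N))`. -/
theorem sum_neg_one_pow_choose_div_sub {K : Type*} [Field K] (N : ℕ) (z : K)
    (hz : ∀ i ≤ N, z - (i : K) ≠ 0) :
    ∑ i ∈ Finset.range (N + 1), (-1) ^ i * (N.choose i : K) * (z - i)⁻¹ =
      (-1) ^ N * N.factorial * (∏ i ∈ Finset.range (N + 1), (z - (i : K)))⁻¹ := by
  induction N generalizing z with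
  | zero => simp
  | succ N ih =>
    have ih1 := ih z (fun i hi => hz i (by omega))
    have ih2 := ih (z - 1) (fun i hi => by
      have := hz (i + 1) (by omega)
      rwa [Nat.cast_add_one, add_comm, ← sub_sub] at this)
    -- Pascal's rule writes the sum for N+1 as the difference of the sums for N at z and z-1.
    have e1 : ∑ i ∈ Finset.range (N + 1 + 1), (-1) ^ i * ((N + 1).choose i : K) * (z - i)⁻¹ =
        ∑ i ∈ Finset.range (N + 1), (-1) ^ i * (N.choose i : K) * (z - i)⁻¹ -
        ∑ i ∈ Finset.range (N + 1), (-1) ^ i * (N.choose i : K) * (z - 1 - i)⁻¹ := by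
      rw [Finset.sum_range_succ']
      have : ∑ i ∈ Finset.range (N + 1), (-1) ^ i * (N.choose i : K) * (z - i)⁻¹ =
          ∑ i ∈ Finset.range (N + 1), (-1) ^ (i + 1) * (N.choose (i + 1) : K) *
            (z - (i + 1 : ℕ))⁻¹ + z⁻¹ := by
        have q : ∑ i ∈ Finset.range (N + 1), (-1) ^ i * (N.choose i : K) * (z - i)⁻¹ =
            ∑ i ∈ Finset.range (N + 1 + 1), (-1) ^ i * (N.choose i : K) * (z - i)⁻¹ := by
          rw [Finset.sum_range_succ _ (N + 1)]; simp
        rw [q, Finset.sum_range_succ']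
        simp
      rw [this, add_sub_right_comm, ← Finset.sum_sub_distrib]
      simp only [pow_zero, Nat.choose_zero_right, Nat.cast_one, Nat.cast_zero, sub_zero, one_mul]
      congr 1
      refine Finset.sum_congr rfl fun i _ => ?_
      rw [Nat.choose_succ_succ, show z - 1 - (i : K) = z - (i + 1 : ℕ) by push_cast; ring]
      push_cast
      ring
    rw [e1, ih1, ih2]
    have p1 : ∏ i ∈ Finset.range (N + 1 + 1), (z - (i : K)) =
        (∏ i ∈ Finset.range (N + 1), (z - (i : K))) * (z - (N + 1)) := by
      rw [Finset.prod_range_succ]; push_cast; rfl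
    have p2 : ∏ i ∈ Finset.range (N + 1 + 1), (z - (i : K)) =
        (∏ i ∈ Finset.range (N + 1), (z - 1 - (i : K))) * z := by
      rw [Finset.prod_range_succ']
      simp only [Nat.cast_zero, sub_zero]
      congr 1
      refine Finset.prod_congr rfl fun i _ => by push_cast; ring
    have n0 : ∏ i ∈ Finset.range (N + 1 + 1), (z - (i : K)) ≠ 0 :=
      Finset.prod_ne_zero_iff.2 fun i hi => hz i (by rw [Finset.mem_range] at hi; omega)
    set A := ∏ i ∈ Finset.range (N + 1), (z - (i : K))
    set B := ∏ i ∈ Finset.range (N + 1), (z - 1 - (i : K))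
    set D := ∏ i ∈ Finset.range (N + 1 + 1), (z - (i : K))
    have a1 : A⁻¹ = (z - (N + 1)) * D⁻¹ := by
      rw [p1] at n0 ⊢
      rw [mul_inv, mul_comm A⁻¹, ← mul_assoc, mul_inv_cancel₀ (right_ne_zero_of_mul n0), one_mul]
    have a2 : B⁻¹ = z * D⁻¹ := by
      rw [p2] at n0 ⊢
      rw [mul_inv, mul_comm B⁻¹, ← mul_assoc, mul_inv_cancel₀ (right_ne_zero_of_mul n0), one_mul]
    rw [a1, a2, Nat.factorial_succ]
    push_cast
    ring

theorem sum_range_neg_one_pow_sub_add_two (a : ℕ → ℤ) (D : ℕ) :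
    ∑ e ∈ Finset.range D, (-1) ^ e * (a e - a (e + 2)) =
      a 0 - a 1 - (-1) ^ D * (a D - a (D + 1)) := by
  induction D with
  | zero => simp
  | succ D ih => rw [Finset.sum_range_succ, ih, pow_succ]; ring

theorem succ_mul_choose_succ_eq_sub_mul (N k : ℕ) :
    ((k : ℤ) + 1) * N.choose (k + 1) = (N - k) * N.choose k := by
  have := congrArg (Nat.cast : ℕ → ℤ) (Nat.choose_succ_right_eq N k)
  push_cast at this
  rcases le_or_gt k N with h | h
  · rw [Nat.cast_sub h] at this
    linear_combination this
  · rw [Nat.choose_eq_zero_of_lt h, Nat.choose_eq_zero_of_lt (by omega)]; simp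

/-- Each term is (M+1)(C(2M,M+e) - C(2M,M+e+2)) up to sign, so the alternating sum telescopes. -/
theorem sum_neg_one_pow_mul_succ_mul_choose (M : ℕ) :
    ∑ e ∈ Finset.range (M + 1), (-1 : ℤ) ^ e * ((e + 1) * (2 * M + 2).choose (M + e + 2)) =
      (2 * M).choose M := by
  have h1 : ∀ e ∈ Finset.range (M + 1),
      (-1 : ℤ) ^ e * ((e + 1) * (2 * M + 2).choose (M + e + 2)) =
      (M + 1) * ((-1) ^ e * (((2 * M).choose (M + e) : ℤ) - (2 * M).choose (M + (e + 2)))) := by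
    intro e _
    have h1 := succ_mul_choose_succ_eq_sub_mul (2 * M) (M + e)
    have h2 := succ_mul_choose_succ_eq_sub_mul (2 * M) (M + e + 1)
    have h3 : ((2 * M + 2).choose (M + e + 2) : ℤ) = (2 * M).choose (M + e) +
        2 * (2 * M).choose (M + e + 1) + (2 * M).choose (M + e + 2) := by
      rw [Nat.choose_succ_succ, Nat.choose_succ_succ, Nat.choose_succ_succ (2 * M) (M + e + 1)]
      push_cast
      ring
    push_cast at h1 h2
    rw [h3, ← add_assoc M e 2]
    linear_combination (-1 : ℤ) ^ e * (h1 + h2)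
  rw [Finset.sum_congr rfl h1, ← Finset.mul_sum,
    sum_range_neg_one_pow_sub_add_two (fun e => ((2 * M).choose (M + e) : ℤ))]
  have h := succ_mul_choose_succ_eq_sub_mul (2 * M) M
  simp only [Nat.choose_eq_zero_of_lt (show 2 * M < M + (M + 1) by omega),
    Nat.choose_eq_zero_of_lt (show 2 * M < M + (M + 1 + 1) by omega), add_zero]
  push_cast at h ⊢
  linear_combination -h

theorem choose_two_mul_add_two_mul (M d : ℕ) :
    ((2 * M + 2).choose (M + 1 + d) : ℤ) * ((M + 1) ^ 2 - d ^ 2) =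
      (2 * M + 2) * (2 * M + 1) * (2 * M).choose (M + d) := by
  have h1 := congrArg (Nat.cast : ℕ → ℤ) (Nat.add_one_mul_choose_eq (2 * M + 1) (M + d))
  have h2 := succ_mul_choose_succ_eq_sub_mul (2 * M) (M + d)
  have h3 : ((2 * M + 1).choose (M + d + 1) : ℤ) = _ :=
    congrArg (Nat.cast : ℕ → ℤ) (Nat.choose_succ_succ (2 * M) (M + d))
  have h4 := succ_mul_choose_succ_eq_sub_mul (2 * M + 1) (M + d)
  rw [show M + 1 + d = M + d + 1 by ring]
  push_cast at *
  rw [h3] at h4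
  linear_combination (-(M + 1 - d : ℤ)) * h1 + (2 * M + 2 : ℤ) * (h2 - h4)

/-- Induction on M. Split (M+1)²/(e+1) as ((M+1)² - (e+1)²)/(e+1) + (e+1): the first part reduces to
the sum for M, the second is `sum_neg_one_pow_mul_succ_mul_choose`. After division by the central
binomial coefficient, the increment is 1/(2M+1) - 1/(2M+2). -/
theorem sum_neg_one_pow_choose_mul_inv {K : Type*} [Field K] (M : ℕ)
    (hK : ∀ k, 0 < k → k ≤ 2 * M → (k : K) ≠ 0) :
    ∑ e ∈ Finset.range M, (-1) ^ e * ((2 * M).choose (M + e + 1) : K) * ((e + 1 : ℕ) : K)⁻¹ =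
      (2 * M).choose M * ∑ j ∈ Finset.Icc 1 (2 * M), (-1) ^ (j - 1) * (j : K)⁻¹ := by
  induction M with
  | zero => simp
  | succ M ih =>
    have ih := ih fun k h0 hk => hK k h0 (by omega)
    have n1 : ((M + 1 : ℕ) : K) ≠ 0 := hK _ (by omega) (by omega)
    have n2 : ((2 * M + 1 : ℕ) : K) ≠ 0 := hK _ (by omega) (by omega)
    have n3 : ((2 * M + 2 : ℕ) : K) ≠ 0 := hK _ (by omega) (by omega)
    have hc : ((M : K) + 1) * (2 * M + 2).choose (M + 1) = 2 * (2 * M + 1) * (2 * M).choose M := by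
      have := Nat.succ_mul_centralBinom_succ M
      rw [Nat.centralBinom_eq_two_mul_choose, Nat.centralBinom_eq_two_mul_choose] at this
      exact_mod_cast congrArg (Nat.cast : ℕ → K) this
    have hs := congrArg (Int.cast : ℤ → K) (sum_neg_one_pow_mul_succ_mul_choose M)
    have hF : ((M : K) + 1) ^ 2 * ∑ e ∈ Finset.range (M + 1),
          (-1) ^ e * ((2 * M + 2).choose (M + e + 2) : K) * ((e + 1 : ℕ) : K)⁻¹ =
        2 * (2 * M + 1) * (M + 1) * ∑ e ∈ Finset.range M,
          (-1) ^ e * ((2 * M).choose (M + e + 1) : K) * ((e + 1 : ℕ) : K)⁻¹ +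
        (2 * M).choose M := by
      have hx : ∑ e ∈ Finset.range M,
          (-1) ^ e * ((2 * M).choose (M + e + 1) : K) * ((e + 1 : ℕ) : K)⁻¹ =
          ∑ e ∈ Finset.range (M + 1),
          (-1) ^ e * ((2 * M).choose (M + e + 1) : K) * ((e + 1 : ℕ) : K)⁻¹ := by
        rw [Finset.sum_range_succ, Nat.choose_eq_zero_of_lt (show 2 * M < M + M + 1 by omega)]
        simp
      push_cast at hs
      rw [hx, ← hs, Finset.mul_sum, Finset.mul_sum, ← Finset.sum_add_distrib]
      refine Finset.sum_congr rfl fun e he => ?_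
      rw [Finset.mem_range] at he
      have ne : ((e + 1 : ℕ) : K) ≠ 0 := hK _ (by omega) (by omega)
      have h1 := congrArg (Int.cast : ℤ → K) (choose_two_mul_add_two_mul M (e + 1))
      rw [show M + 1 + (e + 1) = M + e + 2 by ring] at h1
      push_cast at h1 ne ⊢
      field_simp
      rw [← add_assoc] at h1
      linear_combination h1
    rw [show 2 * (M + 1) = 2 * M + 1 + 1 by ring, Finset.sum_Icc_succ_top (by omega),
      Finset.sum_Icc_succ_top (by omega)]
    apply mul_left_cancel₀ (pow_ne_zero 2 n1)
    have e1 : ∑ e ∈ Finset.range (M + 1),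
          (-1) ^ e * ((2 * M + 1 + 1).choose (M + 1 + e + 1) : K) * ((e + 1 : ℕ) : K)⁻¹ =
        ∑ e ∈ Finset.range (M + 1),
          (-1) ^ e * ((2 * M + 2).choose (M + e + 2) : K) * ((e + 1 : ℕ) : K)⁻¹ :=
      Finset.sum_congr rfl fun e _ => by rw [show M + 1 + e + 1 = M + e + 2 by ring]
    rw [e1]
    have ev : Even (2 * M) := even_two_mul M
    simp only [Nat.add_sub_cancel, pow_succ, ev.neg_one_pow]
    simp only [← pow_succ]
    push_cast at n1 n2 n3 hF ih ⊢
    rw [hF, ih]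
    set H := ∑ j ∈ Finset.Icc 1 (2 * M), (-1) ^ (j - 1) * (j : K)⁻¹
    have i2 := mul_inv_cancel₀ n2
    have i3 := mul_inv_cancel₀ n3
    rw [show (2 * (M : K) + 1 + 1) = 2 * M + 2 by ring]
    set a := (2 * (M : K) + 1)⁻¹
    set b := (2 * (M : K) + 2)⁻¹
    linear_combination (-(M + 1 : K) * (H + a - b)) * hc -
      ((2 * M).choose M : K) * (2 * M + 2) * i2 + ((2 * M).choose M : K) * (2 * M + 1) * i3

/-- With i = m-1-e, use 2m C(2m-1,m+e) = (m+e+1) C(2m,m+e+1) and (m+e+1)/(e+1) = 1 + m/(e+1). The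
part with 1 telescopes; the other is `sum_neg_one_pow_choose_mul_inv`. -/
theorem sum_neg_one_pow_choose_pred_mul_inv {K : Type*} [Field K] (m : ℕ) (hm : 0 < m)
    (hK : ∀ k, 0 < k → k ≤ 2 * m → (k : K) ≠ 0) :
    4 * m * (-1) ^ m * ∑ i ∈ Finset.range m,
        (-1) ^ i * ((2 * m - 1).choose i : K) * ((m : K) - i)⁻¹ =
      -((2 * m).choose m *
        (2 * m * (∑ j ∈ Finset.Icc 1 (2 * m), (-1) ^ (j - 1) * (j : K)⁻¹) + 1)) := by
  obtain ⟨r, rfl⟩ : ∃ r, m = r + 1 := ⟨m - 1, by omega⟩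
  have h1 := sum_neg_one_pow_choose_mul_inv (r + 1) hK
  have h2 : 2 * ∑ e ∈ Finset.range (r + 1),
        (-1 : K) ^ e * ((2 * (r + 1)).choose (r + 1 + e + 1) : K) =
      (2 * (r + 1)).choose (r + 1) := by
    have ht : ∀ D, ∑ e ∈ Finset.range D,
        (-1 : K) ^ e * ((2 * (r + 1)).choose (r + 1 + e + 1) : K) =
        (2 * r + 1).choose (r + 1) - (-1) ^ D * (2 * r + 1).choose (r + 1 + D) := by
      intro D
      induction D with
      | zero => simp
      | succ D ih =>
        rw [Finset.sum_range_succ, ih, show 2 * (r + 1) = (2 * r + 1) + 1 by ring,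
          Nat.choose_succ_succ (2 * r + 1) (r + 1 + D), pow_succ, Nat.succ_eq_add_one,
          add_assoc (r + 1) D 1]
        push_cast
        ring
    rw [ht, Nat.choose_eq_zero_of_lt (show 2 * r + 1 < r + 1 + (r + 1) by omega),
      show 2 * (r + 1) = (2 * r + 1) + 1 by ring, Nat.choose_succ_succ (2 * r + 1) r,
      ← Nat.choose_symm_half r]
    push_cast
    ring
  have h3 : 4 * ((r + 1 : ℕ) : K) * (-1) ^ (r + 1) * ∑ i ∈ Finset.range (r + 1),
        (-1) ^ i * ((2 * (r + 1) - 1).choose i : K) * (((r + 1 : ℕ) : K) - i)⁻¹ =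
      -2 * ((r + 1 : ℕ) : K) * ∑ e ∈ Finset.range (r + 1),
        (-1) ^ e * ((2 * (r + 1)).choose (r + 1 + e + 1) : K) * ((e + 1 : ℕ) : K)⁻¹ -
      2 * ∑ e ∈ Finset.range (r + 1), (-1) ^ e * ((2 * (r + 1)).choose (r + 1 + e + 1) : K) := by
    rw [← Finset.sum_range_reflect, Finset.mul_sum, Finset.mul_sum, Finset.mul_sum,
      ← Finset.sum_sub_distrib]
    refine Finset.sum_congr rfl fun e he => ?_
    rw [Finset.mem_range] at he
    have ne : ((e + 1 : ℕ) : K) ≠ 0 := hK _ (by omega) (by omega)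
    have s1 : (2 * (r + 1) - 1).choose (r + 1 - 1 - e) = (2 * r + 1).choose (r + 1 + e) := by
      rw [show 2 * (r + 1) - 1 = 2 * r + 1 by omega]
      exact Nat.choose_symm_of_eq_add (by omega)
    have s2 : (((r + 1 : ℕ) : K) - (r + 1 - 1 - e : ℕ)) = (e + 1 : ℕ) := by
      rw [sub_eq_iff_eq_add]
      exact_mod_cast congrArg (Nat.cast : ℕ → K) (show r + 1 = (e + 1) + (r + 1 - 1 - e) by omega)
    have s3 : (-1 : K) ^ (r + 1) * (-1) ^ (r + 1 - 1 - e) = - (-1) ^ e := by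
      have q : (-1 : K) ^ (r + 1) = (-1) ^ (r + 1 - 1 - e) * (-1) ^ e * (-1) := by
        rw [← pow_add, ← pow_succ]; congr 1; omega
      have q2 : (-1 : K) ^ (r + 1 - 1 - e) * (-1) ^ (r + 1 - 1 - e) = 1 := by
        rw [← mul_pow]; simp
      rw [q]
      linear_combination (-(-1 : K) ^ e) * q2
    have s4 := congrArg (Nat.cast : ℕ → K) (Nat.add_one_mul_choose_eq (2 * r + 1) (r + 1 + e))
    rw [s1, s2, show 2 * (r + 1) = 2 * r + 1 + 1 by ring]
    push_cast at s3 s4 ne ⊢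
    field_simp
    linear_combination (4 * (r + 1) * ((2 * r + 1).choose (r + 1 + e) : K)) * s3 -
      2 * (-1 : K) ^ e * s4
  rw [h3, h2, h1]
  ring

/-! ### The character sum modulo p² -/

namespace ZMod

variable {p : ℕ} [Fact p.Prime]

theorem isUnit_of_redSq_ne_zero {z : ZMod (p ^ 2)} (hz : redSq p z ≠ 0) : IsUnit z := by
  have hp : p.Prime := Fact.out
  obtain ⟨k, rfl⟩ := ZMod.natCast_zmod_surjective z
  rw [redSq_natCast, Ne, ZMod.natCast_eq_zero_iff] at hz
  exact (ZMod.isUnit_iff_coprime k (p ^ 2)).2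
    (Nat.Coprime.pow_right 2 (Nat.coprime_comm.1 ((Nat.Prime.coprime_iff_not_dvd hp).2 hz)))

/-- Orthogonality: if some a has a^e ≠ 1, multiplying by a permutes the terms, and T(a)^e - 1 is a
unit because its reduction is nonzero. -/
theorem sum_teich_pow {e : ℕ} (he : 0 < e) :
    ∑ t : ZMod p, teich p t ^ e = if p - 1 ∣ e then (p : ZMod (p ^ 2)) - 1 else 0 := by
  have hp : p.Prime := Fact.out
  split_ifs with h
  · have h1 : ∀ t : ZMod p, teich p t ^ e = 1 - if t = 0 then 1 else 0 := by
      intro t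
      rw [← teich_pow]
      split_ifs with h0
      · rw [h0, zero_pow he.ne', teich_zero, sub_self]
      · obtain ⟨c, rfl⟩ := h
        rw [pow_mul, ZMod.pow_card_sub_one_eq_one h0, one_pow, teich_one, sub_zero]
    simp only [h1]
    simp [ZMod.card]
  · have h1 : ¬ ∀ x : (ZMod p)ˣ, x ^ e = 1 := by
      rw [FiniteField.forall_pow_eq_one_iff, ZMod.card]
      exact h
    push Not at h1
    obtain ⟨a, ha⟩ := h1
    have h2 : teich p a ^ e * ∑ t : ZMod p, teich p t ^ e = ∑ t : ZMod p, teich p t ^ e := by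
      rw [Finset.mul_sum]
      simp only [← mul_pow, ← teich_mul]
      exact Fintype.sum_equiv (Units.mulLeft a) _ _ fun t => rfl
    have h3 : IsUnit (teich p a ^ e - 1) := by
      apply isUnit_of_redSq_ne_zero
      rw [map_sub, map_pow, redSq_teich, map_one, sub_ne_zero]
      intro h
      exact ha (Units.ext (by simpa using h))
    apply h3.mul_left_cancel
    rw [sub_mul, h2]
    ring

theorem sum_pow_eq {e : ℕ} (he : 0 < e) :
    ∑ t : ZMod p, t ^ e = if p - 1 ∣ e then -1 else 0 := by
  have h := congrArg (redSq p) (sum_teich_pow (p := p) he)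
  rw [map_sum, apply_ite (redSq p)] at h
  simpa [redSq_teich] using h

theorem quadraticChar_eq_teich_pow (hp2 : p ≠ 2) (a : ZMod p) :
    ((quadraticChar (ZMod p) a : ℤ) : ZMod (p ^ 2)) = teich p a ^ (p / 2) := by
  have hodd := (Fact.out : p.Prime).odd_of_ne_two hp2
  have h := quadraticChar_eq_pow_of_char_ne_two' (F := ZMod p) (by rwa [ZMod.ringChar_zmod_n]) a
  rw [ZMod.card] at h
  rw [← teich_pow, ← h]
  by_cases ha : a = 0
  · simp [ha, teich_zero]
  · rcases quadraticChar_dichotomy ha with h1 | h1 <;> rw [h1]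
    · simp [teich_one]
    · simp [teich_neg hodd, teich_one]

/-- The exponents 2m+2j run from 2m to 6m, so only j = m gives a multiple of p-1 = 4m. -/
theorem sum_teich_pow_mul_one_sub_sq_pow {m : ℕ} (hm : p = 4 * m + 1) :
    ∑ t : ZMod p, teich p t ^ (2 * m) * (1 - teich p t ^ 2) ^ (2 * m) =
      ((p : ZMod (p ^ 2)) - 1) * (-1) ^ m * (2 * m).choose m := by
  have hm0 : 0 < m := by have := (Fact.out : p.Prime).two_le; omega
  have h1 : ∀ t : ZMod p, teich p t ^ (2 * m) * (1 - teich p t ^ 2) ^ (2 * m) =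
      ∑ j ∈ Finset.range (2 * m + 1),
        (-1) ^ j * (2 * m).choose j * teich p t ^ (2 * m + 2 * j) := by
    intro t
    rw [sub_eq_neg_add, add_pow, Finset.mul_sum]
    refine Finset.sum_congr rfl fun j _ => ?_
    rw [one_pow, neg_pow, ← pow_mul, pow_add]
    ring
  simp only [h1]
  rw [Finset.sum_comm, Finset.sum_eq_single m]
  · rw [← Finset.mul_sum, sum_teich_pow (by omega), if_pos ⟨1, by omega⟩]
    ring
  · intro j hj hjm
    rw [Finset.mem_range] at hj
    rw [← Finset.mul_sum, sum_teich_pow (by omega), if_neg, mul_zero]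
    rintro ⟨c, hc⟩
    rw [hm, Nat.add_sub_cancel] at hc
    have : c < 2 := by by_contra h; push Not at h; nlinarith
    interval_cases c <;> omega
  · intro h
    exact absurd (Finset.mem_range.2 (by omega)) h

theorem sum_pow_mul_one_sub_sq_pow_mul_truncLog {m : ℕ} (hm : p = 4 * m + 1) :
    ∑ t : ZMod p, t ^ (2 * m) * ((1 - t ^ 2) ^ (2 * m - 1) * truncLog p (t ^ 2)) =
      - ∑ i ∈ Finset.range (2 * m), (-1) ^ i * ((2 * m - 1).choose i : ZMod p) *
        ∑ k ∈ Finset.Ico 1 p, if 2 * m ∣ m + i + k then (k : ZMod p)⁻¹ else 0 := by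
  have hm0 : 0 < m := by have := (Fact.out : p.Prime).two_le; omega
  have h1 : ∀ t : ZMod p, t ^ (2 * m) * ((1 - t ^ 2) ^ (2 * m - 1) * truncLog p (t ^ 2)) =
      ∑ i ∈ Finset.range (2 * m), ∑ k ∈ Finset.Ico 1 p, (-1) ^ i *
        ((2 * m - 1).choose i : ZMod p) * (k : ZMod p)⁻¹ * t ^ (2 * (m + i + k)) := by
    intro t
    rw [sub_eq_neg_add, add_pow, truncLog, Finset.sum_mul_sum, Finset.mul_sum,
      Nat.sub_add_cancel (by omega)]
    refine Finset.sum_congr rfl fun i _ => ?_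
    rw [Finset.mul_sum]
    refine Finset.sum_congr rfl fun k _ => ?_
    rw [one_pow, neg_pow, ← pow_mul, ← pow_mul, mul_add, mul_add, pow_add, pow_add]
    ring
  simp only [h1]
  rw [Finset.sum_comm, ← Finset.sum_neg_distrib]
  refine Finset.sum_congr rfl fun i _ => ?_
  rw [Finset.sum_comm, Finset.mul_sum, ← Finset.sum_neg_distrib]
  refine Finset.sum_congr rfl fun k _ => ?_
  rw [← Finset.mul_sum, sum_pow_eq (by omega)]
  have h2 : p - 1 ∣ 2 * (m + i + k) ↔ 2 * m ∣ m + i + k := by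
    rw [show p - 1 = 2 * (2 * m) by omega]
    exact Nat.mul_dvd_mul_iff_left (by norm_num)
  simp only [h2]
  split_ifs <;> ring

/-- Exactly two k in [1, 4m] satisfy k ≡ m-i modulo 2m: one is 3m-i, the other m-i or 5m-i. In the
last case 4m = -1 in the field. -/
theorem sum_inv_ite_dvd {m : ℕ} (hm : p = 4 * m + 1) {i : ℕ} (hi : i < 2 * m) :
    (∑ k ∈ Finset.Ico 1 p, if 2 * m ∣ m + i + k then (k : ZMod p)⁻¹ else 0) =
      (3 * (m : ZMod p) - i)⁻¹ +
        if i < m then ((m : ZMod p) - i)⁻¹ else ((m : ZMod p) - 1 - i)⁻¹ := by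
  rw [← Finset.sum_filter]
  have hp0 : 4 * (m : ZMod p) + 1 = 0 := by
    have : (p : ZMod p) = 0 := ZMod.natCast_self p
    rw [← this]
    exact_mod_cast congrArg (Nat.cast : ℕ → ZMod p) hm.symm
  have hpair : ∀ a b : ℕ, a ≠ b →
      (Finset.Ico 1 p).filter (fun k => 2 * m ∣ m + i + k) = {a, b} →
      ∑ k ∈ (Finset.Ico 1 p).filter (fun k => 2 * m ∣ m + i + k), (k : ZMod p)⁻¹ =
        (a : ZMod p)⁻¹ + (b : ZMod p)⁻¹ := by
    intro a b hab h
    rw [h, Finset.sum_pair hab]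
  split_ifs with him
  · rw [hpair (3 * m - i) (m - i) (by omega)]
    · rw [Nat.cast_sub (by omega), Nat.cast_sub (by omega)]
      push_cast
      rfl
    · ext k
      simp only [Finset.mem_filter, Finset.mem_Ico, Finset.mem_insert, Finset.mem_singleton]
      constructor
      · rintro ⟨⟨h1, h2⟩, c, hc⟩
        have c1 : c < 3 := by by_contra h; push Not at h; nlinarith
        interval_cases c <;> omega
      · rintro (rfl | rfl)
        · exact ⟨by omega, 2, by omega⟩
        · exact ⟨by omega, 1, by omega⟩
  · rw [hpair (3 * m - i) (5 * m - i) (by omega)]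
    · rw [Nat.cast_sub (by omega), Nat.cast_sub (by omega)]
      push_cast
      congr 2
      linear_combination hp0
    · ext k
      simp only [Finset.mem_filter, Finset.mem_Ico, Finset.mem_insert, Finset.mem_singleton]
      constructor
      · rintro ⟨⟨h1, h2⟩, c, hc⟩
        have c1 : c < 4 := by by_contra h; push Not at h; nlinarith
        interval_cases c <;> omega
      · rintro (rfl | rfl)
        · exact ⟨by omega, 2, by omega⟩
        · exact ⟨by omega, 3, by omega⟩

theorem sum_quadraticChar_eq_mulP {m : ℕ} (hm : p = 4 * m + 1) :
    ((∑ t : ZMod p, quadraticChar (ZMod p) (t * (1 - t ^ 2)) : ℤ) : ZMod (p ^ 2)) =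
      ((p : ZMod (p ^ 2)) - 1) * (-1) ^ m * (2 * m).choose m +
      mulP p (2 * m * ∑ i ∈ Finset.range (2 * m), (-1) ^ i * ((2 * m - 1).choose i : ZMod p) *
        ((3 * (m : ZMod p) - i)⁻¹ +
          if i < m then ((m : ZMod p) - i)⁻¹ else ((m : ZMod p) - 1 - i)⁻¹)) := by
  have hm0 : 0 < m := by have := (Fact.out : p.Prime).two_le; omega
  have h1 : ∀ t : ZMod p,
      ((quadraticChar (ZMod p) (t * (1 - t ^ 2)) : ℤ) : ZMod (p ^ 2)) =
      teich p t ^ (2 * m) * (1 - teich p t ^ 2) ^ (2 * m) - mulP p (2 * m *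
        (t ^ (2 * m) * ((1 - t ^ 2) ^ (2 * m - 1) * truncLog p (t ^ 2)))) := by
    intro t
    rw [quadraticChar_eq_teich_pow (by omega), show p / 2 = 2 * m by omega, teich_mul, mul_pow,
      teich_one_sub ⟨2 * m, by omega⟩, teich_pow, sub_eq_add_neg _ (mulP p _), ← map_neg,
      add_mulP_pow, mul_add, mul_comm _ (mulP p _), mulP_mul, sub_eq_add_neg _ (mulP p _),
      ← map_neg]
    simp only [map_sub, map_one, map_pow, redSq_teich]
    push_cast
    congr 2
    ring
  push_cast
  simp only [h1]
  rw [Finset.sum_sub_distrib, sum_teich_pow_mul_one_sub_sq_pow hm, ← map_sum, ← Finset.mul_sum,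
    sum_pow_mul_one_sub_sq_pow_mul_truncLog hm, sub_eq_add_neg, ← map_neg, mul_neg, neg_neg]
  congr 3
  refine Finset.sum_congr rfl fun i hi => ?_
  rw [sum_inv_ite_dvd hm (Finset.mem_range.1 hi)]

end ZMod

namespace ZMod

variable {p : ℕ} [Fact p.Prime]

/-- Under i ↦ 2m-1-i both the sign and the denominator change sign, so the two halves agree. -/
theorem sum_neg_one_pow_choose_ite {m : ℕ} :
    ∑ i ∈ Finset.range (2 * m), (-1) ^ i * ((2 * m - 1).choose i : ZMod p) *
        (if i < m then ((m : ZMod p) - i)⁻¹ else ((m : ZMod p) - 1 - i)⁻¹) =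
      2 * ∑ i ∈ Finset.range m, (-1) ^ i * ((2 * m - 1).choose i : ZMod p) *
        ((m : ZMod p) - i)⁻¹ := by
  rw [two_mul m, Finset.sum_range_add, two_mul (∑ i ∈ _, _)]
  congr 1
  · refine Finset.sum_congr rfl fun i hi => ?_
    rw [if_pos (Finset.mem_range.1 hi)]
  · rw [← Finset.sum_range_reflect (fun i => (-1) ^ i * ((m + m - 1).choose i : ZMod p) *
        ((m : ZMod p) - i)⁻¹)]
    refine Finset.sum_congr rfl fun x hx => ?_
    rw [Finset.mem_range] at hx
    obtain ⟨y, rfl⟩ : ∃ y, m = x + 1 + y := ⟨m - 1 - x, by omega⟩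
    rw [if_neg (by omega), show x + 1 + y - 1 - x = y by omega,
      Nat.choose_symm_of_eq_add (show x + 1 + y + (x + 1 + y) - 1 = x + 1 + y + x + y by omega)]
    have e1 : (((x + 1 + y : ℕ) : ZMod p) - 1 - (x + 1 + y + x : ℕ))⁻¹ =
        -(((x + 1 + y : ℕ) : ZMod p) - y)⁻¹ := by
      rw [← inv_neg]; congr 1; push_cast; ring
    have e2 : (-1 : ZMod p) ^ (x + 1 + y + x) = - (-1) ^ y := by
      rw [show x + 1 + y + x = 2 * x + 1 + y by ring, pow_add, pow_add, pow_mul]; simp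
    rw [e1, e2]
    ring

/-- Both sides are compared through factorials, using C(4m,m) ≡ (-1)^m and C(4m,2m) ≡ 1 modulo p. -/
theorem factorial_mul_choose_eq_descFactorial {m : ℕ} (hm : p = 4 * m + 1) :
    (-1) ^ m * ((2 * m).factorial : ZMod p) * (2 * m).choose m =
      ((3 * m).descFactorial (2 * m) : ZMod p) := by
  have c1 := choose_pred_prime (p := p) m (by omega)
  have c2 := choose_pred_prime (p := p) (2 * m) (by omega)
  have d1 := congrArg (Nat.cast : ℕ → ZMod p)
    (Nat.choose_mul_factorial_mul_factorial (show m ≤ 4 * m by omega))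
  have d2 := congrArg (Nat.cast : ℕ → ZMod p)
    (Nat.choose_mul_factorial_mul_factorial (show 2 * m ≤ 4 * m by omega))
  have d3 := congrArg (Nat.cast : ℕ → ZMod p)
    (Nat.choose_mul_factorial_mul_factorial (show m ≤ 2 * m by omega))
  have d4 := congrArg (Nat.cast : ℕ → ZMod p)
    (Nat.factorial_mul_descFactorial (show 2 * m ≤ 3 * m by omega))
  rw [show p - 1 = 4 * m by omega] at c1 c2
  rw [show 4 * m - m = 3 * m by omega] at d1
  rw [show 4 * m - 2 * m = 2 * m by omega] at d2
  rw [show 2 * m - m = m by omega] at d3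
  rw [show 3 * m - 2 * m = m by omega] at d4
  push_cast at d1 d2 d3 d4
  rw [c1] at d1
  rw [c2, pow_mul, neg_one_sq, one_pow, one_mul] at d2
  have hf : (m.factorial : ZMod p) ≠ 0 := by
    rw [Ne, ZMod.natCast_eq_zero_iff, (Fact.out : p.Prime).dvd_factorial]; omega
  have hs : ((-1 : ZMod p) ^ m) * (-1) ^ m = 1 := by rw [← mul_pow]; simp
  apply mul_left_cancel₀ (pow_ne_zero 2 hf)
  have e : (-1 : ZMod p) ^ m * m.factorial * (m.factorial * (3 * m).descFactorial (2 * m)) =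
      (2 * m).factorial * ((2 * m).choose m * m.factorial * m.factorial) := by
    rw [d4, d3, d1, d2]
  linear_combination (-(-1 : ZMod p) ^ m) * e +
    (m.factorial ^ 2 * (3 * m).descFactorial (2 * m) : ZMod p) * hs

theorem choose_half_ne_zero {m : ℕ} (hm : p = 4 * m + 1) : ((2 * m).choose m : ZMod p) ≠ 0 := by
  have hp : p.Prime := Fact.out
  rw [Ne, ZMod.natCast_eq_zero_iff, ← Nat.Prime.coprime_iff_not_dvd hp]
  exact hp.coprime_choose_of_lt (by omega) (by omega)

/-- Partial fractions with N = 2m-1 at z = 3m; the product in the denominator is the descending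
factorial just evaluated. -/
theorem sum_choose_mul_inv_eq {m : ℕ} (hm : p = 4 * m + 1) :
    -((-1) ^ m * (2 * m * ∑ i ∈ Finset.range (2 * m), (-1) ^ i * ((2 * m - 1).choose i : ZMod p) *
      (3 * (m : ZMod p) - i)⁻¹)) = ((2 * m).choose m : ZMod p)⁻¹ := by
  have hm0 : 0 < m := by have := (Fact.out : p.Prime).two_le; omega
  obtain ⟨r, hr⟩ : ∃ r, 2 * m = r + 1 := ⟨2 * m - 1, by omega⟩
  have hcast : ∀ i ≤ r, (3 * (m : ZMod p) - i) = (3 * m - i : ℕ) := by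
    intro i hi
    rw [Nat.cast_sub (by omega)]; push_cast; rfl
  have h1 := sum_neg_one_pow_choose_div_sub r (3 * (m : ZMod p)) fun i hi => by
    rw [hcast i hi]
    exact natCast_ne_zero_of_lt (by omega) (by omega)
  have h2 : ∏ i ∈ Finset.range (r + 1), (3 * (m : ZMod p) - (i : ZMod p)) =
      ((3 * m).descFactorial (2 * m) : ZMod p) := by
    rw [Nat.descFactorial_eq_prod_range, hr, Nat.cast_prod]
    refine Finset.prod_congr rfl fun i hi => hcast i ?_
    rw [Finset.mem_range] at hi; omega
  rw [h2, ← factorial_mul_choose_eq_descFactorial hm] at h1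
  have h3 : ((2 * m).factorial : ZMod p) = 2 * m * r.factorial := by
    have := congrArg (Nat.cast : ℕ → ZMod p) (Nat.factorial_succ r)
    rw [← hr] at this
    push_cast at this
    exact this
  have hf : ((2 * m).factorial : ZMod p) ≠ 0 := by
    rw [Ne, ZMod.natCast_eq_zero_iff, (Fact.out : p.Prime).dvd_factorial]; omega
  have ho : (-1 : ZMod p) ^ r = -1 := Odd.neg_one_pow ⟨m - 1, by omega⟩
  rw [show 2 * m - 1 = r by omega, hr, h1, ho, ← hr]
  have hs : ((-1 : ZMod p) ^ m) ≠ 0 := pow_ne_zero _ (by simp)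
  have hc := choose_half_ne_zero hm
  rw [h3] at hf ⊢
  have hf1 := left_ne_zero_of_mul hf
  have hf2 := right_ne_zero_of_mul hf
  field_simp
  exact div_self hf1

/-- The correction splits into the 3m-i part, giving p/C, and the folded part, giving -pCH/2 + pC.
The last term cancels the -pC contained in the main term -(p-1)C. -/
theorem neg_sum_quadraticChar_eq {m : ℕ} (hm : p = 4 * m + 1) :
    -((-1) ^ m *
      ((∑ t : ZMod p, quadraticChar (ZMod p) (t * (1 - t ^ 2)) : ℤ) : ZMod (p ^ 2))) =
    (2 * m).choose m * (1 - mulP p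
      ((∑ j ∈ Finset.Icc 1 (2 * m), (-1) ^ (j - 1) * (j : ZMod p)⁻¹) * 2⁻¹)) +
      mulP p ((2 * m).choose m : ZMod p)⁻¹ := by
  have hp : p.Prime := Fact.out
  have hm0 : 0 < m := by have := hp.two_le; omega
  have h2 : (2 : ZMod p) ≠ 0 := by
    exact_mod_cast natCast_ne_zero_of_lt (p := p) (k := 2) (by norm_num) (by omega)
  have hp0 : 4 * (m : ZMod p) + 1 = 0 := by
    have : (p : ZMod p) = 0 := ZMod.natCast_self p
    rw [← this]
    exact_mod_cast congrArg (Nat.cast : ℕ → ZMod p) hm.symm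
  have hhalf : 2 * (m : ZMod p) = -2⁻¹ := by
    field_simp
    linear_combination hp0
  have hE := sum_neg_one_pow_choose_pred_mul_inv (K := ZMod p) m hm0
    fun k h0 hk => natCast_ne_zero_of_lt h0 (by omega)
  have hS := sum_choose_mul_inv_eq hm
  rw [sum_quadraticChar_eq_mulP hm]
  simp only [mul_add, Finset.sum_add_distrib]
  rw [sum_neg_one_pow_choose_ite]
  set H := ∑ j ∈ Finset.Icc 1 (2 * m), (-1) ^ (j - 1) * (j : ZMod p)⁻¹
  set E := ∑ i ∈ Finset.range m, (-1) ^ i * ((2 * m - 1).choose i : ZMod p) * ((m : ZMod p) - i)⁻¹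
  set S := ∑ i ∈ Finset.range (2 * m), (-1) ^ i * ((2 * m - 1).choose i : ZMod p) *
      (3 * (m : ZMod p) - i)⁻¹
  have hs : ((-1 : ZMod (p ^ 2)) ^ m) * (-1) ^ m = 1 := by rw [← mul_pow]; simp
  have k1 : mulP p (2 * m * S + 2 * m * (2 * E)) * (-1) ^ m =
      mulP p (-((2 * m).choose m : ZMod p)⁻¹ + (2 * m).choose m * (H * 2⁻¹) -
        (2 * m).choose m) := by
    rw [mulP_mul]
    congr 1
    simp only [map_pow, map_neg, map_one]
    rw [← hS]
    linear_combination hE - ((2 * m).choose m * H) * hhalf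
  have k2 : mulP p ((2 * m).choose m * (H * 2⁻¹)) = (2 * m).choose m * mulP p (H * 2⁻¹) := by
    rw [mul_comm ((2 * m).choose m : ZMod (p ^ 2)), mulP_mul, redSq_natCast, mul_comm]
  have k3 : mulP p ((2 * m).choose m : ZMod p) = p * (2 * m).choose m := by
    rw [← redSq_natCast, mulP_redSq]
  rw [map_sub, map_add, map_add, map_neg, k2, k3] at k1
  rw [map_add]
  linear_combination -k1 - (((p : ZMod (p ^ 2)) - 1) * (2 * m).choose m) * hs

end ZMod

/-! ### Jacobsthal sums over ℤ -/

section Jacobsthal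

variable {p : ℕ} [Fact p.Prime]

theorem quadraticChar_neg_one_of_mod_four (hp : p % 4 = 1) :
    quadraticChar (ZMod p) (-1) = 1 := by
  rw [quadraticChar_one_iff_isSquare (by simp)]
  exact ZMod.exists_sq_eq_neg_one_iff.2 (by omega)

theorem ZMod.ringChar_ne_two (hp2 : p ≠ 2) : ringChar (ZMod p) ≠ 2 := by
  rwa [ZMod.ringChar_zmod_n]

/-- For a ≠ b the substitution k = a + (b-a)x turns the sum into the Jacobi sum of χ with itself, up
to χ(-1). -/
theorem sum_quadraticChar_sub_mul_sub (hp2 : p ≠ 2) (a b : ZMod p) :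
    ∑ k : ZMod p, quadraticChar (ZMod p) ((a - k) * (b - k)) =
      -1 + if a = b then (p : ℤ) else 0 := by
  split_ifs with h
  · have h1 : ∀ k : ZMod p, quadraticChar (ZMod p) ((a - k) * (b - k)) =
        1 - if k = a then 1 else 0 := by
      intro k
      rw [h]
      split_ifs with hk
      · simp [hk]
      · rw [← pow_two, quadraticChar_sq_one' (sub_ne_zero.2 (Ne.symm hk)), sub_zero]
    simp only [h1]
    simp [ZMod.card]
    ring
  · have hc : b - a ≠ 0 := sub_ne_zero.2 (Ne.symm h)
    have hJ := jacobiSum_nontrivial_inv (quadraticChar_ne_one (ZMod.ringChar_ne_two hp2))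
    rw [(quadraticChar_isQuadratic (ZMod p)).inv, jacobiSum] at hJ
    have hn : quadraticChar (ZMod p) (-1) * quadraticChar (ZMod p) (-1) = 1 := by
      rw [← map_mul]; simp
    rw [← ((Equiv.mulLeft₀ (b - a) hc).trans (Equiv.addLeft a)).sum_comp]
    have h1 : ∀ x : ZMod p, quadraticChar (ZMod p)
        ((a - ((Equiv.mulLeft₀ (b - a) hc).trans (Equiv.addLeft a)) x) *
          (b - ((Equiv.mulLeft₀ (b - a) hc).trans (Equiv.addLeft a)) x)) =
        quadraticChar (ZMod p) (-1) *
          (quadraticChar (ZMod p) x * quadraticChar (ZMod p) (1 - x)) := by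
      intro x
      change quadraticChar (ZMod p) ((a - (a + (b - a) * x)) * (b - (a + (b - a) * x))) = _
      rw [show (a - (a + (b - a) * x)) * (b - (a + (b - a) * x)) =
        (b - a) ^ 2 * (-1 * (x * (1 - x))) by ring, map_mul, quadraticChar_sq_one' hc, one_mul,
        map_mul, map_mul]
    simp only [h1]
    rw [← Finset.mul_sum, hJ, mul_neg, hn, add_zero]

/-- The Jacobsthal sum attached to `t (t² - k)`. -/
def jacobsthal (p : ℕ) [Fact p.Prime] (k : ZMod p) : ℤ :=
  ∑ t : ZMod p, quadraticChar (ZMod p) (t * (t ^ 2 - k))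

theorem jacobsthal_mul_sq (k a : ZMod p) (ha : a ≠ 0) :
    jacobsthal p (k * a ^ 2) = quadraticChar (ZMod p) a * jacobsthal p k := by
  unfold jacobsthal
  rw [← Equiv.sum_comp (Equiv.mulLeft₀ a ha), Finset.mul_sum]
  refine Finset.sum_congr rfl fun t _ => ?_
  change quadraticChar (ZMod p) (a * t * ((a * t) ^ 2 - k * a ^ 2)) = _
  rw [show a * t * ((a * t) ^ 2 - k * a ^ 2) = a ^ 2 * (a * (t * (t ^ 2 - k))) by ring,
    map_mul, quadraticChar_sq_one' ha, one_mul, map_mul]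

theorem jacobsthal_zero (hp2 : p ≠ 2) : jacobsthal p 0 = 0 := by
  rw [← quadraticChar_sum_zero (ZMod.ringChar_ne_two hp2), jacobsthal]
  refine Finset.sum_congr rfl fun t _ => ?_
  by_cases ht : t = 0
  · simp [ht]
  · rw [sub_zero, mul_comm, map_mul, quadraticChar_sq_one' ht, one_mul]

/-- Expand the square and sum over k first; only u = ±t contribute, equally because χ(-1) = 1. -/
theorem sum_jacobsthal_sq (hp : p % 4 = 1) :
    ∑ k : ZMod p, jacobsthal p k ^ 2 = 2 * p * (p - 1) := by
  have hp2 : p ≠ 2 := by omega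
  have h1 : ∑ k : ZMod p, jacobsthal p k ^ 2 = ∑ t : ZMod p, ∑ u : ZMod p,
      quadraticChar (ZMod p) (t * u) *
        ∑ k : ZMod p, quadraticChar (ZMod p) ((t ^ 2 - k) * (u ^ 2 - k)) := by
    simp only [jacobsthal, pow_two (∑ t : ZMod p, _), Finset.sum_mul_sum]
    rw [Finset.sum_comm]
    refine Finset.sum_congr rfl fun t _ => ?_
    rw [Finset.sum_comm]
    refine Finset.sum_congr rfl fun u _ => ?_
    rw [Finset.mul_sum]
    refine Finset.sum_congr rfl fun k _ => ?_
    rw [← map_mul, ← map_mul]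
    congr 1
    ring
  have h2 : ∀ t : ZMod p, ∑ u : ZMod p, quadraticChar (ZMod p) (t * u) *
      (-1 + if t ^ 2 = u ^ 2 then (p : ℤ) else 0) = (1 - if t = 0 then 1 else 0) * (2 * p) := by
    intro t
    have h0 : ∑ u : ZMod p, quadraticChar (ZMod p) (t * u) = 0 := by
      simp only [map_mul]
      rw [← Finset.mul_sum, quadraticChar_sum_zero (ZMod.ringChar_ne_two hp2), mul_zero]
    simp only [mul_add, Finset.sum_add_distrib, ← Finset.sum_mul, h0]
    split_ifs with ht
    · simp [ht]
    · have hneg : t ≠ -t := by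
        intro h
        have : (2 : ZMod p) * t = 0 := by linear_combination h
        rcases mul_eq_zero.1 this with h | h
        · exact Ring.two_ne_zero (ZMod.ringChar_ne_two hp2) h
        · exact ht h
      simp only [mul_ite, mul_zero]
      rw [← Finset.sum_filter,
        show Finset.univ.filter (fun u : ZMod p => t ^ 2 = u ^ 2) = {t, -t} by
        ext u
        simp only [Finset.mem_filter, Finset.mem_univ, true_and, Finset.mem_insert,
          Finset.mem_singleton]
        rw [eq_comm, sq_eq_sq_iff_eq_or_eq_neg], Finset.sum_pair hneg,
        show t * -t = -1 * (t * t) by ring, map_mul _ (-1),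
        quadraticChar_neg_one_of_mod_four hp, ← pow_two, quadraticChar_sq_one' ht]
      ring
  rw [h1]
  simp only [sum_quadraticChar_sub_mul_sub hp2, h2]
  rw [← Finset.sum_mul]
  simp [ZMod.card]
  ring

/-- By scaling, the square of the sum depends only on the square class of k; b is the sum at a
nonresidue g. Each class has (p-1)/2 elements, so the second moment determines the total. -/
theorem exists_jacobsthal_sq_add_sq (hp : p % 4 = 1) :
    ∃ b : ℤ, jacobsthal p 1 ^ 2 + b ^ 2 = 4 * p := by
  have hp2 : p ≠ 2 := by omega
  obtain ⟨g, hg⟩ := quadraticChar_exists_neg_one (ZMod.ringChar_ne_two hp2)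
  have hg0 : g ≠ 0 := by rintro rfl; simp at hg
  refine ⟨jacobsthal p g, ?_⟩
  have key : ∀ k l : ZMod p, l ≠ 0 → quadraticChar (ZMod p) (k * l) = 1 →
      jacobsthal p k ^ 2 = jacobsthal p l ^ 2 := by
    intro k l hl h
    have hkl : k * l ≠ 0 := by intro h0; simp [h0] at h
    obtain ⟨a, ha⟩ := (quadraticChar_one_iff_isSquare hkl).1 h
    have ha0 : a ≠ 0 := by rintro rfl; exact hkl (by simpa using ha)
    have : k = l * (a / l) ^ 2 := by
      field_simp
      linear_combination ha
    rw [this, jacobsthal_mul_sq _ _ (div_ne_zero ha0 hl), mul_pow,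
      quadraticChar_sq_one (div_ne_zero ha0 hl), one_mul]
  have h1 : ∀ k : ZMod p, 2 * jacobsthal p k ^ 2 =
      (1 - if k = 0 then 1 else 0) * (jacobsthal p 1 ^ 2 + jacobsthal p g ^ 2) +
      quadraticChar (ZMod p) k * (jacobsthal p 1 ^ 2 - jacobsthal p g ^ 2) := by
    intro k
    by_cases hk : k = 0
    · simp [hk, jacobsthal_zero hp2]
    · rw [if_neg hk]
      rcases quadraticChar_dichotomy hk with h | h
      · rw [h, key k 1 one_ne_zero (by rwa [mul_one])]; ring
      · rw [h, key k g hg0 (by rw [map_mul, h, hg]; norm_num)]; ring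
  have h2 : 2 * ∑ k : ZMod p, jacobsthal p k ^ 2 =
      (p - 1) * (jacobsthal p 1 ^ 2 + jacobsthal p g ^ 2) := by
    rw [Finset.mul_sum]
    simp only [h1]
    rw [Finset.sum_add_distrib, ← Finset.sum_mul, ← Finset.sum_mul,
      quadraticChar_sum_zero (ZMod.ringChar_ne_two hp2)]
    simp [ZMod.card]
  rw [sum_jacobsthal_sq hp] at h2
  have h3 : (p : ℤ) - 1 ≠ 0 := by
    have := (Fact.out : p.Prime).two_le; omega
  apply mul_left_cancel₀ h3
  linear_combination -h2

theorem four_dvd_card_of_neg_inv_stable {K : Type*} [Field K] [DecidableEq K] (X : Finset K)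
    (hneg : ∀ t ∈ X, -t ∈ X) (hinv : ∀ t ∈ X, t⁻¹ ∈ X) (h2 : (2 : K) ≠ 0)
    (h0 : ∀ t ∈ X, t ≠ 0) (h1 : ∀ t ∈ X, t ^ 2 ≠ 1) (hi : ∀ t ∈ X, t ^ 2 ≠ -1) :
    4 ∣ X.card := by
  -- The fibres of t² + t⁻² on X are the four-element orbits of t ↦ -t and t ↦ t⁻¹.
  rw [Finset.card_eq_sum_card_image (fun t => t ^ 2 + (t⁻¹) ^ 2) X]
  refine Finset.dvd_sum fun b hb => ?_
  obtain ⟨t, ht, rfl⟩ := Finset.mem_image.1 hb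
  have t0 := h0 t ht
  have t1 := h1 t ht
  have ti := hi t ht
  have n0 : t ≠ -t := by
    intro h
    have : (2 : K) * t = 0 := by linear_combination h
    exact (mul_ne_zero h2 t0) this
  have n1 : t ≠ t⁻¹ := by
    intro h; apply t1; nth_rewrite 1 [pow_two, h]; exact inv_mul_cancel₀ t0
  have n2 : t ≠ -t⁻¹ := by
    intro h; apply ti; rw [pow_two]; nth_rewrite 1 [h]; rw [neg_mul, inv_mul_cancel₀ t0]
  have n3 : -t ≠ t⁻¹ := fun h => n2 (by rw [← h, neg_neg])
  have n4 : -t ≠ -t⁻¹ := fun h => n1 (neg_injective h)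
  have n5 : t⁻¹ ≠ -t⁻¹ := fun h => n0 (by
    have := congrArg (·⁻¹) h
    simpa [inv_neg] using this)
  have hf : X.filter (fun u => u ^ 2 + (u⁻¹) ^ 2 = t ^ 2 + (t⁻¹) ^ 2) = {t, -t, t⁻¹, -t⁻¹} := by
    ext u
    simp only [Finset.mem_filter, Finset.mem_insert, Finset.mem_singleton]
    constructor
    · rintro ⟨hu, h⟩
      have u0 := h0 u hu
      have : (u - t) * (u + t) * ((u * t - 1) * (u * t + 1)) = 0 := by
        field_simp at h
        linear_combination h
      rcases mul_eq_zero.1 this with h | h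
      · rcases mul_eq_zero.1 h with h | h
        · exact Or.inl (sub_eq_zero.1 h)
        · exact Or.inr (Or.inl (eq_neg_of_add_eq_zero_left h))
      · rcases mul_eq_zero.1 h with h | h
        · exact Or.inr (Or.inr (Or.inl (eq_inv_of_mul_eq_one_left (sub_eq_zero.1 h))))
        · refine Or.inr (Or.inr (Or.inr ?_))
          rw [← neg_eq_iff_eq_neg]
          exact eq_inv_of_mul_eq_one_left (by linear_combination -h)
    · rintro (rfl | rfl | rfl | rfl)
      · exact ⟨ht, rfl⟩
      · exact ⟨hneg _ ht, by rw [inv_neg, neg_sq, neg_sq]⟩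
      · exact ⟨hinv _ ht, by rw [inv_inv, add_comm]⟩
      · exact ⟨hneg _ (hinv _ ht), by rw [inv_neg, inv_inv, neg_sq, neg_sq, add_comm]⟩
  rw [hf]
  have : ({t, -t, t⁻¹, -t⁻¹} : Finset K).card = 4 := by
    rw [Finset.card_insert_of_notMem, Finset.card_insert_of_notMem, Finset.card_pair n5]
    · simp only [Finset.mem_insert, Finset.mem_singleton]
      tauto
    · simp only [Finset.mem_insert, Finset.mem_singleton]
      tauto
  rw [this]

/-- The summand vanishes at 0, 1, -1 and is ±1 elsewhere. The set where it is -1 is stable under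
negation and inversion, hence has size 4q. -/
theorem exists_jacobsthal_one_eq (hp : p % 4 = 1) :
    ∃ q : ℤ, jacobsthal p 1 = p - 3 - 8 * q := by
  have hp2 : p ≠ 2 := by omega
  have two0 : (2 : ZMod p) ≠ 0 := Ring.two_ne_zero (ZMod.ringChar_ne_two hp2)
  have hm1 := quadraticChar_neg_one_of_mod_four hp
  set f : ZMod p → ℤ := fun t => quadraticChar (ZMod p) (t * (t ^ 2 - 1)) with hf
  set X := Finset.univ.filter fun t : ZMod p => f t = -1 with hX
  have hmem : ∀ t, t ∈ X ↔ f t = -1 := fun t => by simp [hX]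
  have h0 : ∀ t ∈ X, t ≠ 0 := by
    rintro t ht rfl
    rw [hmem] at ht
    simp [hf] at ht
  have h1 : ∀ t ∈ X, t ^ 2 ≠ 1 := by
    intro t ht h
    rw [hmem] at ht
    simp [hf, h] at ht
  have hX4 : 4 ∣ X.card := by
    refine four_dvd_card_of_neg_inv_stable X ?_ ?_ two0 h0 h1 ?_
    · intro t ht
      rw [hmem] at ht ⊢
      rw [← ht]
      simp only [hf]
      rw [show -t * ((-t) ^ 2 - 1) = -1 * (t * (t ^ 2 - 1)) by ring, map_mul, hm1, one_mul]
    · intro t ht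
      have t0 := h0 t ht
      rw [hmem] at ht ⊢
      rw [← ht]
      simp only [hf]
      rw [show t * (t ^ 2 - 1) = (t ^ 2) ^ 2 * (-1 * (t⁻¹ * (t⁻¹ ^ 2 - 1))) by field_simp; ring,
        map_mul _ ((t ^ 2) ^ 2), quadraticChar_sq_one' (pow_ne_zero 2 t0), one_mul, map_mul _ (-1),
        hm1, one_mul]
    -- If t² = -1, then t(t²-1) = -(1+t)² is a nonzero square, so t is not in X.
    · intro t ht h
      have t0 := h0 t ht
      rw [hmem] at ht
      have hs : t * (t ^ 2 - 1) = -1 * (1 + t) ^ 2 := by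
        linear_combination (t + 1) * h
      have ht1 : 1 + t ≠ 0 := by
        intro h1
        have : (2 : ZMod p) = 0 := by linear_combination (-(t - 1)) * h1 + h
        exact two0 this
      have ht' : f t = 1 := by
        simp only [hf]
        rw [hs, map_mul, hm1, quadraticChar_sq_one' ht1, one_mul]
      rw [ht'] at ht
      norm_num at ht
  have hcase : ∀ t : ZMod p, f t = 1 - (if t = 0 then 1 else 0) - (if t = 1 then 1 else 0) -
      (if t = -1 then 1 else 0) - 2 * (if f t = -1 then 1 else 0) := by
    intro t
    have neg1 : (1 : ZMod p) ≠ -1 := by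
      intro h
      exact two0 (by linear_combination h)
    by_cases e0 : t = 0
    · subst e0; simp [hf]
    by_cases e1 : t = 1
    · subst e1; simp [hf, neg1]
    by_cases e2 : t = -1
    · subst e2; simp [hf, neg1.symm]
    have hne : t * (t ^ 2 - 1) ≠ 0 := by
      rw [show t * (t ^ 2 - 1) = t * ((t - 1) * (t + 1)) by ring]
      exact mul_ne_zero e0 (mul_ne_zero (sub_ne_zero.2 e1)
        fun h => e2 (eq_neg_of_add_eq_zero_left h))
    rw [if_neg e0, if_neg e1, if_neg e2]
    rcases quadraticChar_dichotomy hne with h | h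
    · have : f t = 1 := h
      rw [this]; norm_num
    · have : f t = -1 := h
      rw [this]; norm_num
  obtain ⟨q, hq⟩ := hX4
  refine ⟨q, ?_⟩
  have hsum : jacobsthal p 1 = ∑ t : ZMod p, f t := rfl
  have hcard : ∑ t : ZMod p, (if f t = -1 then (1 : ℤ) else 0) = X.card := by
    rw [hX, Finset.card_filter]; push_cast; rfl
  rw [hsum, Finset.sum_congr rfl fun t _ => hcase t]
  simp only [Finset.sum_sub_distrib, ← Finset.mul_sum, hcard, hq]
  simp [ZMod.card]
  ring

end Jacobsthal

/-! ### Uniqueness of p = x² + y² and the sign of x -/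

theorem Int.sq_eq_sq_of_prime_eq_sq_add_sq {p x y a b : ℤ} (hp : Prime p) (hp0 : 0 < p)
    (h1 : p = x ^ 2 + y ^ 2) (h2 : p = a ^ 2 + b ^ 2) (hx : Odd x) (ha : Odd a) (hpo : Odd p) :
    x ^ 2 = a ^ 2 := by
  have key : ∀ b : ℤ, p = a ^ 2 + b ^ 2 → p ∣ x * b - a * y → x ^ 2 = a ^ 2 := by
    rintro b hb ⟨c, hc⟩
    -- Brahmagupta's identity forces xb - ay to be 0 or ±p. The second case gives xa + yb = 0 and p
    -- = x² + a², which is even.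
    have hsq : (x * a + y * b) ^ 2 + (p * c) ^ 2 = p ^ 2 := by
      rw [← hc]
      linear_combination -p * hb - (a ^ 2 + b ^ 2) * h1
    have hc1 : c ^ 2 ≤ 1 := by nlinarith [sq_nonneg (x * a + y * b), mul_pos hp0 hp0]
    have hc2 : c ^ 2 = 0 ∨ c ^ 2 = 1 := by
      have := sq_nonneg c; omega
    rcases hc2 with h | h
    · have hc0 : c = 0 := pow_eq_zero_iff (two_ne_zero) |>.1 h
      rw [hc0, mul_zero] at hc
      have : p * (x ^ 2 - a ^ 2) = 0 := by
        linear_combination (x * b + a * y) * hc + x ^ 2 * hb - a ^ 2 * h1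
      rcases mul_eq_zero.1 this with h | h
      · omega
      · linarith
    · exfalso
      have h0 : (x * a + y * b) ^ 2 = 0 := by
        rw [mul_pow, h] at hsq; linarith
      have h0 : x * a + y * b = 0 := pow_eq_zero_iff (two_ne_zero) |>.1 h0
      have : p * (p - (x ^ 2 + a ^ 2)) = 0 := by
        linear_combination (-(x * a - y * b)) * h0 + (p - a ^ 2) * h1 + y ^ 2 * hb
      rcases mul_eq_zero.1 this with h | h
      · omega
      · have : Even p := by
          rw [show p = x ^ 2 + a ^ 2 by linarith]
          exact hx.pow.add_odd ha.pow
        exact (Int.not_even_iff_odd.2 hpo) this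
  have hdvd : p ∣ (x * b - a * y) * (x * b + a * y) :=
    ⟨x ^ 2 - a ^ 2, by linear_combination a ^ 2 * h1 - x ^ 2 * h2⟩
  rcases hp.dvd_or_dvd hdvd with h | h
  · exact key b h2 h
  · refine key (-b) (by rw [neg_sq]; exact h2) ?_
    rw [show x * -b - a * y = -(x * b + a * y) by ring]
    exact (dvd_neg).2 h

theorem two_mul_eq_neg_sum_quadraticChar {p m : ℕ} [Fact p.Prime] (hm : p = 4 * m + 1)
    {x y : ℤ} (h : (p : ℤ) = x ^ 2 + y ^ 2) (hx : x ≡ 1 [ZMOD 4]) :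
    2 * x = -((-1) ^ m * ∑ t : ZMod p, quadraticChar (ZMod p) (t * (1 - t ^ 2))) := by
  have hp : p.Prime := Fact.out
  have hp4 : p % 4 = 1 := by omega
  have hA : ∑ t : ZMod p, quadraticChar (ZMod p) (t * (1 - t ^ 2)) = jacobsthal p 1 := by
    refine Finset.sum_congr rfl fun t _ => ?_
    rw [show t * (1 - t ^ 2) = -1 * (t * (t ^ 2 - 1)) by ring, map_mul,
      quadraticChar_neg_one_of_mod_four hp4, one_mul]
  obtain ⟨q, hq⟩ := exists_jacobsthal_one_eq hp4
  obtain ⟨b, hb⟩ := exists_jacobsthal_sq_add_sq hp4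
  have hq' : jacobsthal p 1 = 2 * (2 * m - 1 - 4 * q) := by rw [hq, hm]; push_cast; ring
  set a : ℤ := 2 * m - 1 - 4 * q with ha
  have hbe : Even b := by
    have : Even (b ^ 2) := ⟨2 * (p - a ^ 2), by rw [hq'] at hb; linarith⟩
    exact (Int.even_pow.1 this).1
  obtain ⟨c, hc⟩ := hbe
  have h2 : (p : ℤ) = a ^ 2 + c ^ 2 := by
    rw [hq', hc] at hb; nlinarith
  have hx1 : x % 4 = 1 := hx
  have hsq := Int.sq_eq_sq_of_prime_eq_sq_add_sq (Nat.prime_iff_prime_int.1 hp)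
    (by exact_mod_cast hp.pos) h h2 (Int.odd_iff.2 (by omega)) (Int.odd_iff.2 (by omega))
    (Int.odd_iff.2 (by omega))
  rw [hA, hq']
  -- Since a ≡ 2m-1 modulo 4, the condition x ≡ 1 selects x = -a for even m and x = a for odd m.
  rcases Nat.even_or_odd m with hm' | hm'
  · rw [hm'.neg_one_pow]
    obtain ⟨r, hr⟩ := hm'
    rcases sq_eq_sq_iff_eq_or_eq_neg.1 hsq with e | e
    · exfalso; omega
    · rw [e]; ring
  · rw [hm'.neg_one_pow]
    obtain ⟨r, hr⟩ := hm'
    rcases sq_eq_sq_iff_eq_or_eq_neg.1 hsq with e | e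
    · rw [e]; ring
    · exfalso; omega

/-! ### Return to rational numbers and conclusion -/

theorem ratModEq_prime_sq_of_sub_eq_div {p : ℕ} (hp : p.Prime) {a b : ℚ} {M D : ℤ}
    (hD : ¬ (p : ℤ) ∣ D)
    (h : a - b = M / D) (hM : (M : ZMod (p ^ 2)) = 0) : RatModEq (p ^ 2) a b := by
  rw [ZMod.intCast_zmod_eq_zero_iff_dvd] at hM
  obtain ⟨c, rfl⟩ := hM
  refine ⟨c / D, ?_, by rw [h]; push_cast; ring⟩
  refine Nat.Coprime.pow_right 2 (Nat.Coprime.symm ((Nat.Prime.coprime_iff_not_dvd hp).2 ?_))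
  intro hd
  refine hD (dvd_trans (Int.natCast_dvd_natCast.2 hd) ?_)
  have := Rat.den_dvd c D
  rwa [Rat.divInt_eq_div] at this

theorem sum_centralBinom_sq_div_eq (p : ℕ) (hp : 0 < p) :
    ∑ k ∈ Finset.range p, (Nat.choose (2 * k) k : ℚ) ^ 2 / (32 : ℚ) ^ k =
      ((∑ k ∈ Finset.range p, ((2 * k).choose k : ℤ) ^ 2 * 32 ^ (p - 1 - k) : ℤ) : ℚ) /
        ((32 ^ (p - 1) : ℤ) : ℚ) := by
  push_cast
  rw [Finset.sum_div]
  refine Finset.sum_congr rfl fun k hk => ?_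
  rw [Finset.mem_range] at hk
  rw [div_eq_div_iff (by positivity) (by positivity), mul_assoc, ← pow_add]
  congr 2
  omega

/-- Multiply 2x(1+μ) = C + ν by 2x: as 2x ≡ C modulo p, 2xν = p, while pμ = 0 lets the factor 1+μ be
pulled out. -/
theorem two_mul_mul_choose_eq {p m : ℕ} [Fact p.Prime] (hm : p = 4 * m + 1)
    {x y : ℤ} (h : (p : ℤ) = x ^ 2 + y ^ 2) (hx : x ≡ 1 [ZMOD 4]) :
    2 * (x : ZMod (p ^ 2)) * ((-1) ^ m * (2 * m).choose m) =
      2 ^ (2 * m) * (4 * (x : ZMod (p ^ 2)) ^ 2 - p) := by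
  have hA := congrArg (Int.cast : ℤ → ZMod (p ^ 2)) (two_mul_eq_neg_sum_quadraticChar hm h hx)
  rw [Int.cast_neg, Int.cast_mul, Int.cast_mul, Int.cast_pow, Int.cast_neg, Int.cast_one,
    Int.cast_ofNat] at hA
  have h1 := hA.trans (ZMod.neg_sum_quadraticChar_eq hm)
  have h2 := ZMod.two_pow_eq_mulP hm
  set H := ∑ j ∈ Finset.Icc 1 (2 * m), (-1) ^ (j - 1) * (j : ZMod p)⁻¹
  have hc := ZMod.choose_half_ne_zero hm
  have h3 : ZMod.redSq p (2 * (x : ZMod (p ^ 2))) = (2 * m).choose m := by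
    rw [h1, map_add, map_mul, map_sub, ZMod.redSq_mulP, ZMod.redSq_mulP, map_natCast, map_one]
    ring
  have h4 : ZMod.mulP p ((2 * m).choose m : ZMod p)⁻¹ * (2 * (x : ZMod (p ^ 2))) = p := by
    rw [ZMod.mulP_mul, h3, inv_mul_cancel₀ hc, ZMod.mulP_one]
  have h5 : (p : ZMod (p ^ 2)) * ZMod.mulP p (H * 2⁻¹) = 0 := by
    rw [← ZMod.mulP_one, ZMod.mulP_mul_mulP]
  have h6 := ZMod.mulP_mul_mulP (p := p) (H * 2⁻¹) (H * 2⁻¹)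
  have h7 := ZMod.mulP_mul_mulP (p := p) ((2 * m).choose m : ZMod p)⁻¹ (H * 2⁻¹)
  have hs : ((-1 : ZMod (p ^ 2)) ^ m) * (-1) ^ m = 1 := by rw [← mul_pow]; simp
  set μ := ZMod.mulP p (H * 2⁻¹)
  set ν := ZMod.mulP p ((2 * m).choose m : ZMod p)⁻¹
  set c := ((2 * m).choose m : ZMod (p ^ 2))
  set X := (x : ZMod (p ^ 2))
  have h8 : 2 * X * (1 + μ) = c + ν := by
    linear_combination (1 + μ) * h1 - c * h6 + h7
  have h9 : 2 * X * c = (1 + μ) * (4 * X ^ 2 - p) := by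
    linear_combination (-2 * X) * h8 - h4 + h5
  have h10 : (2 : ZMod (p ^ 2)) ^ (2 * m) = (-1) ^ m * (1 + μ) := by
    rw [← h2]
    linear_combination (-2 ^ (2 * m)) * hs
  rw [h10]
  linear_combination (-1) ^ m * h9

theorem mainTheorem4 (p : ℕ) (hp : p.Prime) :
    (p % 4 = 3 →
      RatModEq (p ^ 2)
        (∑ k ∈ Finset.range p, (Nat.choose (2 * k) k : ℚ) ^ 2 / (32 : ℚ) ^ k) 0) ∧
    (p % 4 = 1 → ∀ x y : ℤ, (p : ℤ) = x ^ 2 + y ^ 2 → x ≡ 1 [ZMOD 4] →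
      RatModEq (p ^ 2)
        (∑ k ∈ Finset.range p, (Nat.choose (2 * k) k : ℚ) ^ 2 / (32 : ℚ) ^ k)
        (2 * (x : ℚ) - (p : ℚ) / (2 * (x : ℚ)))) := by
  have : Fact p.Prime := ⟨hp⟩
  have h2 : p ≠ 2 → ¬ (p : ℤ) ∣ 2 := fun h hd =>
    h ((Nat.prime_dvd_prime_iff_eq hp Nat.prime_two).1 (by exact_mod_cast hd))
  have h32 : p ≠ 2 → ¬ (p : ℤ) ∣ 32 ^ (p - 1) := fun h hd => by
    have := (Nat.prime_iff_prime_int.1 hp).dvd_of_dvd_pow hd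
    rw [show (32 : ℤ) = 2 ^ 5 by norm_num] at this
    exact h2 h ((Nat.prime_iff_prime_int.1 hp).dvd_of_dvd_pow this)
  constructor
  · intro h3
    obtain ⟨n, hn⟩ : ∃ n, p = 2 * n + 1 := ⟨p / 2, by omega⟩
    refine ratModEq_prime_sq_of_sub_eq_div hp (h32 (by omega))
      (by rw [sub_zero]; exact sum_centralBinom_sq_div_eq p hp.pos) ?_
    have hs := sum_centralBinom_sq_eq_zmod_sq hp hn
    rw [sum_shiftedLegendre_two_pow_odd n (Nat.odd_iff.2 (by omega)), Int.cast_zero, mul_zero] at hs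
    push_cast
    exact hs
  · intro h1 x y hxy hx
    obtain ⟨m, hm⟩ : ∃ m, p = 4 * m + 1 := ⟨p / 4, by omega⟩
    have hx1 : x % 4 = 1 := hx
    have hx0 : x ≠ 0 := by rintro rfl; norm_num at hx1
    -- Otherwise p² ≤ x² ≤ p.
    have hpx : ¬ (p : ℤ) ∣ x := by
      intro hd
      have h3 : (p : ℤ) ^ 2 ∣ x ^ 2 := pow_dvd_pow_of_dvd hd 2
      have h4 := Int.le_of_dvd (by positivity) h3
      have h5 : (2 : ℤ) ≤ p := by exact_mod_cast hp.two_le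
      nlinarith [sq_nonneg y]
    have hpr := Nat.prime_iff_prime_int.1 hp
    set N : ℤ := ∑ k ∈ Finset.range p, ((2 * k).choose k : ℤ) ^ 2 * 32 ^ (p - 1 - k) with hN
    -- Clearing the denominators 32^(p-1) and 2x, both prime to p, leaves a congruence between
    -- integers.
    refine ratModEq_prime_sq_of_sub_eq_div hp (M := 2 * x * N - 32 ^ (p - 1) * (4 * x ^ 2 - p))
      (D := 2 * x * 32 ^ (p - 1)) ?_ ?_ ?_
    · intro hd
      rcases hpr.dvd_or_dvd hd with hd | hd
      · rcases hpr.dvd_or_dvd hd with hd | hd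
        · exact h2 (by omega) hd
        · exact hpx hd
      · exact h32 (by omega) hd
    · rw [sum_centralBinom_sq_div_eq p hp.pos, ← hN]
      have : (x : ℚ) ≠ 0 := by exact_mod_cast hx0
      push_cast
      field_simp
      ring
    · have hs := sum_centralBinom_sq_eq_zmod_sq hp (n := 2 * m) (by omega)
      rw [sum_shiftedLegendre_two_pow_even m] at hs
      have hNc : (N : ZMod (p ^ 2)) = 16 ^ (2 * (2 * m)) * 2 ^ (2 * m) *
          (((-1) ^ m * (2 * m).choose m : ℤ) : ZMod (p ^ 2)) := by
        rw [← hs, hN]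
        push_cast
        rfl
      have hk := two_mul_mul_choose_eq hm hxy hx
      have e32 : (32 : ZMod (p ^ 2)) ^ (p - 1) =
          16 ^ (2 * (2 * m)) * 2 ^ (2 * m) * 2 ^ (2 * m) := by
        rw [mul_assoc, ← pow_add, ← two_mul, ← mul_pow, show p - 1 = 2 * (2 * m) by omega]
        norm_num
      push_cast
      rw [hNc, e32]
      push_cast
      linear_combination (16 ^ (2 * (2 * m)) * 2 ^ (2 * m)) * hk
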